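/- Let $N\ge 1$ be an integer, $s\in(0,1)$, $0<\beta\le N+2s$ and $C_0>0$. Write $\psi_\beta(x)=(1+|x|^2)^{-\beta/2}$, let $$\mathcal L^s(\mathbb R^N)=\Big\{f:\mathbb R^N\to\mathbb R \text{ measurable}:\ \int_{\mathbb R^N}\frac{|f(x)|}{1+|x|^{N+2s}}\,dx<\infty\Big\},$$ and let $$(-\Delta)^s u(x)=C_{N,s}\lim_{\varepsilon\to0^+}\int_{\{|x-y|\ge\varepsilon\}}\frac{u(x)-u(y)}{|x-y|^{N+2s}}\,dy,\qquad C_{N,s}=\frac{2^{2s-1}\,2s\,\Gamma((N+2s)/2)}{\pi^{N/2}\,\Gamma(1-s)},$$ whenever the limit exists and is finite. Then there is a constant $K$, depending only on $N,s,\beta,C_0$, such that the following holds. Let $\rho,c:\mathbb R^N\to\mathbb R$ be continuous with $\rho(x)\ge C_0$ and $c(x)\ge c_0$ for all $x\in\mathbb R^N$, where $c_0>0$ is a constant. Let $p\in[1,\infty)$ satisfy $p\,c_0>K$, and let $u\in C^2(\mathbb R^N)\cap\mathcal L^s(\mathbb R^N)$ be a classical solution of $$\Delta u-(-\Delta)^s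 u-\rho\,c\,u=0\quad\text{in }\mathbb R^N$$ (the equation holds at every point) such that $|u|^p\in\mathcal L^s(\mathbb R^N)$ and $u\in L^p_{\psi_\beta}(\mathbb R^N)$, that is, $\int_{\mathbb R^N}|u|^p\,\psi_\beta\,dx<\infty$. Then $u\equiv0$ in $\mathbb R^N$. -/

import Mathlib

open MeasureTheory Filter Topology

noncomputable section

/-- The normalization constant
`C_{N,s} = 2^{2s-1} 2s Γ((N+2s)/2) / (π^{N/2} Γ(1-s))` of the fractional Laplacian. -/
def fracLapConst (N : ℕ) (s : ℝ) : ℝ :=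
  (2 : ℝ) ^ (2 * s - 1) * (2 * s) * Real.Gamma ((N + 2 * s) / 2) /
    (Real.pi ^ ((N : ℝ) / 2) * Real.Gamma (1 - s))

/-- `HasFracLaplacianAt s u x v`: the principal value
`C_{N,s} lim_{ε → 0⁺} ∫_{|x-y| ≥ ε} (u(x) - u(y)) / |x-y|^{N+2s} dy`
exists, is finite, and equals `v`; that is, `(-Δ)^s u(x) = v`. The sign is the one for which
`(-Δ)^s` has Fourier symbol `|ξ|^{2s}`. -/
def HasFracLaplacianAt {N : ℕ} (s : ℝ) (u : EuclideanSpace ℝ (Fin N) → ℝ)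
    (x : EuclideanSpace ℝ (Fin N)) (v : ℝ) : Prop :=
  Tendsto
    (fun ε : ℝ => fracLapConst N s *
      ∫ y in {y : EuclideanSpace ℝ (Fin N) | ε ≤ ‖x - y‖},
        (u x - u y) / ‖x - y‖ ^ ((N : ℝ) + 2 * s))
    (𝓝[>] 0) (𝓝 v)

/-- The space `𝓛^s(ℝ^N)` of (measurable) functions with
`∫ |f(x)| / (1 + |x|^{N+2s}) dx < ∞`. -/
def MemLs {N : ℕ} (s : ℝ) (f : EuclideanSpace ℝ (Fin N) → ℝ) : Prop :=
  Integrable (fun x => f x / (1 + ‖x‖ ^ ((N : ℝ) + 2 * s)))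

/-- The weighted Lebesgue space `L^p_f(ℝ^N)`, `1 ≤ p < ∞`, of (measurable) functions with
`∫ |u|^p f dx < ∞`. -/
def MemWeightedLp {N : ℕ} (p : ℝ) (f : EuclideanSpace ℝ (Fin N) → ℝ)
    (u : EuclideanSpace ℝ (Fin N) → ℝ) : Prop :=
  AEStronglyMeasurable u ∧ Integrable (fun x => |u x| ^ p * f x)

/-- The weight `ψ_β(x) = (1 + |x|²)^{-β/2}`. -/
def psiWeight {N : ℕ} (β : ℝ) (x : EuclideanSpace ℝ (Fin N)) : ℝ :=
  (1 + ‖x‖ ^ 2) ^ (-β / 2)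

/-- The condition on `ρ`: it is continuous and `ρ(x) ≥ C₀ (1 + |x|²)^{-α/2}`. -/
structure DensityCondition {N : ℕ} (α C₀ : ℝ) (ρ : EuclideanSpace ℝ (Fin N) → ℝ) : Prop where
  continuous : Continuous ρ
  lower_bound : ∀ x, C₀ * (1 + ‖x‖ ^ 2) ^ (-α / 2) ≤ ρ x

/-- The condition on `c`: it is continuous and nonnegative. -/
structure PotentialCondition {N : ℕ} (c : EuclideanSpace ℝ (Fin N) → ℝ) : Prop where
  continuous : Continuous c
  nonneg : ∀ x, 0 ≤ c x

/-- Classical solutions of `Δu - (-Δ)^s u - ρ c u = 0` in `ℝ^N`: functions in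
`C²(ℝ^N) ∩ 𝓛^s(ℝ^N)` that satisfy the equation at every point. -/
structure IsClassicalSolution {N : ℕ} (s : ℝ) (ρ c u : EuclideanSpace ℝ (Fin N) → ℝ) :
    Prop where
  contDiff : ContDiff ℝ 2 u
  memLs : MemLs s u
  equation : ∀ x, ∃ v, HasFracLaplacianAt s u x v ∧
    Laplacian.laplacian u x - v - ρ x * c x * u x = 0

end

/-! The operator `Δ - (-Δ)^s` is the limit, on `C²` functions of `𝓛^s`, of the jump operators
`f ↦ ∫ (f(x+z) - f(x)) dμ_ε(z)` of finite symmetric measures: the Lévy density of `-(-Δ)^s` cut off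
at `|z| = ε`, plus Dirac masses producing second differences. A jump operator is self-adjoint, and
the subgradient inequality for `|·|^p` gives `p |u|^{p-2} u Ju ≤ J|u|^p`. Testing with compactly
supported `φ ↑ ψ_{N+2s}` chosen such that `Jφ ≤ K ψ_{N+2s}` uniformly in `ε` and in the cutoff, and
letting `ε → 0`, one gets `p q ∫ |u|^p ψ_{N+2s} ≤ K ∫ |u|^p ψ_{N+2s}` for every lower bound `q` of
`ρ c`. Both integrals are finite because `|u|^p ∈ 𝓛^s`, so `p q > K` forces `u = 0`. -/

noncomputable section

section SecondDifferences

variable {E : Type*} [NormedAddCommGroup E] [NormedSpace ℝ E]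

lemma norm_sub_sub_fderiv_le_of_convex {F : Type*} [NormedAddCommGroup F] [NormedSpace ℝ F]
    {f : E → F} (hf : ContDiff ℝ 2 f) {s : Set E} (hs : Convex ℝ s) {M : ℝ}
    (hM : ∀ y ∈ s, ‖fderiv ℝ (fderiv ℝ f) y‖ ≤ M) {x z : E} (hx : x ∈ s) (hxz : x + z ∈ s) :
    ‖f (x + z) - f x - fderiv ℝ f x z‖ ≤ M * ‖z‖ ^ 2 := by
  have hd : Differentiable ℝ (fderiv ℝ f) :=
    (hf.fderiv_right (m := 1) le_rfl).differentiable one_ne_zero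
  have hM0 : 0 ≤ M := (norm_nonneg (fderiv ℝ (fderiv ℝ f) x)).trans (hM x hx)
  have hseg : segment ℝ x (x + z) ⊆ s := hs.segment_subset hx hxz
  have hlip : ∀ w ∈ segment ℝ x (x + z), ‖fderiv ℝ f w - fderiv ℝ f x‖ ≤ M * ‖z‖ := fun w hw =>
    (hs.norm_image_sub_le_of_norm_fderiv_le (fun v _ => hd v) hM hx (hseg hw)).trans <| by
      gcongr
      simpa using norm_sub_le_of_mem_segment hw
  have h := (convex_segment x (x + z)).norm_image_sub_le_of_norm_fderiv_le'
    (fun w _ => hf.differentiable two_ne_zero w) hlip (left_mem_segment ℝ x (x + z))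
    (right_mem_segment ℝ x (x + z))
  rwa [add_sub_cancel_left, mul_assoc, ← sq] at h

lemma exists_abs_second_difference_le [ProperSpace E] {u : E → ℝ} (hu : ContDiff ℝ 2 u) (R : ℝ) :
    ∃ M, 0 ≤ M ∧ ∀ x z : E, ‖x‖ ≤ R → ‖z‖ ≤ 1 →
      |u (x + z) + u (x - z) - 2 * u x| ≤ M * ‖z‖ ^ 2 := by
  have hcont : Continuous (fderiv ℝ (fderiv ℝ u)) :=
    (hu.fderiv_right (m := 1) le_rfl).continuous_fderiv one_ne_zero
  obtain ⟨M, hM⟩ := (isCompact_closedBall (0 : E) (R + 1)).exists_bound_of_continuousOn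
    (f := fderiv ℝ (fderiv ℝ u)) hcont.continuousOn
  refine ⟨2 * |M|, by positivity, fun x z hx hz => ?_⟩
  have htaylor (w : E) (hw : ‖w‖ ≤ 1) : |u (x + w) - u x - fderiv ℝ u x w| ≤ |M| * ‖w‖ ^ 2 := by
    have hxw : x + w ∈ Metric.closedBall 0 (R + 1) := by
      simpa using (norm_add_le x w).trans (add_le_add hx hw)
    exact norm_sub_sub_fderiv_le_of_convex hu (convex_closedBall 0 (R + 1))
      (fun y hy => (hM y hy).trans (le_abs_self M))
      (by simpa using hx.trans (le_add_of_nonneg_right zero_le_one)) hxw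
  have h₁ := htaylor z hz
  have h₂ := htaylor (-z) (by rwa [norm_neg])
  rw [map_neg, norm_neg, ← sub_eq_add_neg] at h₂
  rw [abs_le] at h₁ h₂ ⊢
  constructor <;> linarith

lemma tendsto_second_difference {u : E → ℝ} (hu : ContDiff ℝ 2 u) (x e : E) :
    Tendsto (fun ε : ℝ => (u (x + ε • e) + u (x - ε • e) - 2 * u x) / ε ^ 2) (𝓝[>] 0)
      (𝓝 (fderiv ℝ (fderiv ℝ u) x e e)) := by
  set h : ℝ → ℝ := fun t => fderiv ℝ u (x + t • e) e
  have hline (t : ℝ) : HasDerivAt (fun t : ℝ => x + t • e) e t := by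
    simpa using ((hasDerivAt_id t).smul_const e).const_add x
  have hu' (t : ℝ) : HasDerivAt (fun t => u (x + t • e)) (h t) t :=
    (hu.differentiable two_ne_zero _).hasFDerivAt.comp_hasDerivAt t (hline t)
  have hh : HasDerivAt h (fderiv ℝ (fderiv ℝ u) x e e) 0 := by
    have hd := ((hu.fderiv_right (m := 1) le_rfl).differentiable one_ne_zero
      (x + (0 : ℝ) • e)).hasFDerivAt.comp_hasDerivAt 0 (hline 0)
    simpa [h] using hd.clm_apply (hasDerivAt_const 0 e)
  have hnum (t : ℝ) : HasDerivAt (fun t => u (x + t • e) + u (x - t • e) - 2 * u x)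
      (h t - h (-t)) t := by
    have := ((hu' t).add ((hu' (-t)).scomp t (hasDerivAt_neg t))).sub_const (2 * u x)
    simpa [sub_eq_add_neg] using this
  have hslope : Tendsto (fun t => (h t - h (-t)) / (2 * t)) (𝓝[>] 0)
      (𝓝 (fderiv ℝ (fderiv ℝ u) x e e)) := by
    have hodd : HasDerivAt (fun t => h t - h (-t)) (2 * fderiv ℝ (fderiv ℝ u) x e e) 0 :=
      (hh.sub (HasDerivAt.scomp (0 : ℝ) (g₁ := h) (by rwa [neg_zero])
        (hasDerivAt_neg (0 : ℝ)))).congr_deriv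
        (by simp [two_mul])
    have := (hasDerivAt_iff_tendsto_slope_zero.1 hodd).mono_left
      (nhdsWithin_mono 0 fun t (ht : 0 < t) => ht.ne')
    refine ((this.const_mul (1 / 2)).congr fun t => ?_).trans_eq ?_
    · simp only [zero_add, neg_zero, sub_self, sub_zero, smul_eq_mul]
      ring
    · ring_nf
  refine HasDerivAt.lhopital_zero_nhdsGT (Eventually.of_forall hnum)
    (Eventually.of_forall fun t => by simpa using hasDerivAt_pow 2 t)
    (eventually_mem_nhdsWithin.mono fun t (ht : 0 < t) => by positivity) ?_ ?_ hslope
  · have := (hnum 0).continuousAt.tendsto.mono_left (nhdsWithin_le_nhds (s := Set.Ioi 0))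
    simpa [two_mul] using this
  · have := ((continuous_pow 2).tendsto (0 : ℝ)).mono_left (nhdsWithin_le_nhds (s := Set.Ioi 0))
    simpa using this

end SecondDifferences

section RealPowers

lemma one_sub_mul_sub_one_le_rpow_neg {b t : ℝ} (hb : 0 ≤ b) (ht : 0 < t) :
    1 - b * (t - 1) ≤ t ^ (-b) := by
  have hexp := Real.add_one_le_exp (Real.log t * -b)
  have hlog := mul_le_mul_of_nonneg_left (Real.log_le_sub_one_of_pos ht) hb
  rw [Real.rpow_def_of_pos ht]
  linarith

lemma rpow_neg_le_one_sub_mul {b t : ℝ} (hb : 0 ≤ b) (ht : 0 < t) :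
    t ^ (-b) ≤ 1 - b * t ^ (-(b + 1)) * (t - 1) := by
  have h := mul_le_mul_of_nonneg_left (one_sub_mul_sub_one_le_rpow_neg hb (inv_pos.2 ht))
    (Real.rpow_nonneg ht.le (-b))
  have hinv : t ^ (-b) * t⁻¹ ^ (-b) = 1 := by
    rw [← Real.mul_rpow ht.le (inv_pos.2 ht).le, mul_inv_cancel₀ ht.ne', Real.one_rpow]
  have hsucc : t ^ (-b) * t⁻¹ = t ^ (-(b + 1)) := by
    rw [neg_add, ← sub_eq_add_neg, Real.rpow_sub_one ht.ne', div_eq_mul_inv]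
  have hsucc' : t ^ (-(b + 1)) * t = t ^ (-b) := by rw [← hsucc]; field_simp
  rw [hinv] at h
  linear_combination h + b * hsucc + b * hsucc'

lemma abs_rpow_neg_sub_one_add_le {a t : ℝ} (ha : 0 ≤ a) (ht : 1 / 4 ≤ t) :
    |t ^ (-a) - 1 + a * (t - 1)| ≤ a * ((a + 1) * 4 ^ (a + 2)) * (t - 1) ^ 2 := by
  have ht0 : 0 < t := by linarith
  have hlower := one_sub_mul_sub_one_le_rpow_neg ha ht0
  have hupper := rpow_neg_le_one_sub_mul ha ht0
  rw [abs_of_nonneg (by linarith)]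
  have hC : (1 : ℝ) ≤ 4 ^ (a + 2) := Real.one_le_rpow (by norm_num) (by linarith)
  suffices (t - 1) * (1 - t ^ (-(a + 1))) ≤ (a + 1) * 4 ^ (a + 2) * (t - 1) ^ 2 by
    nlinarith [mul_le_mul_of_nonneg_left this ha]
  rcases le_total 1 t with h1 | h1
  · have := one_sub_mul_sub_one_le_rpow_neg (b := a + 1) (by linarith) ht0
    calc (t - 1) * (1 - t ^ (-(a + 1))) ≤ (t - 1) * ((a + 1) * (t - 1)) := by
          gcongr; linarith
      _ = (a + 1) * 1 * (t - 1) ^ 2 := by ring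
      _ ≤ _ := by gcongr
  · have hpow : t ^ (-(a + 1 + 1)) ≤ 4 ^ (a + 2) := by
      calc t ^ (-(a + 1 + 1)) ≤ (1 / 4) ^ (-(a + 1 + 1)) :=
            Real.rpow_le_rpow_of_nonpos (by norm_num) ht (by linarith)
        _ = 4 ^ (a + 2) := by
            rw [one_div, Real.inv_rpow (by norm_num), Real.rpow_neg (by norm_num), inv_inv]
            ring_nf
    have := rpow_neg_le_one_sub_mul (b := a + 1) (by linarith) ht0
    calc (t - 1) * (1 - t ^ (-(a + 1)))
        = (1 - t) * (t ^ (-(a + 1)) - 1) := by ring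
      _ ≤ (1 - t) * ((a + 1) * t ^ (-(a + 1 + 1)) * (1 - t)) := by
          gcongr; linarith
      _ = (a + 1) * t ^ (-(a + 1 + 1)) * (t - 1) ^ 2 := by ring
      _ ≤ _ := by gcongr

lemma sq_max_zero_le (a b : ℝ) :
    max b 0 ^ 2 ≤ max a 0 ^ 2 + 2 * max a 0 * (b - a) + (b - a) ^ 2 := by
  rcases le_total a 0 with ha | ha <;> rcases le_total b 0 with hb | hb <;>
    simp only [max_eq_left, max_eq_right, ha, hb] <;> nlinarith

end RealPowers

variable {N : ℕ}

local notation "ℝ^[" N "]" => EuclideanSpace ℝ (Fin N)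

section Weight

lemma psiWeight_pos (γ : ℝ) (x : ℝ^[N]) : 0 < psiWeight γ x :=
  Real.rpow_pos_of_pos (by positivity) _

lemma psiWeight_le_one {γ : ℝ} (hγ : 0 ≤ γ) (x : ℝ^[N]) : psiWeight γ x ≤ 1 :=
  Real.rpow_le_one_of_one_le_of_nonpos (by nlinarith [sq_nonneg ‖x‖]) (by linarith)

lemma continuous_psiWeight (γ : ℝ) : Continuous (psiWeight γ : ℝ^[N] → ℝ) :=
  Continuous.rpow_const (by fun_prop) fun x => Or.inl (by positivity)

lemma integrable_psiWeight {γ : ℝ} (hγ : N < γ) : Integrable (psiWeight γ : ℝ^[N] → ℝ) :=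
  integrable_rpow_neg_one_add_norm_sq (by simpa using hγ)

lemma psiWeight_mul_rpow (γ : ℝ) (x : ℝ^[N]) : psiWeight γ x * (1 + ‖x‖ ^ 2) ^ (γ / 2) = 1 := by
  rw [psiWeight, neg_div, Real.rpow_neg (by positivity), inv_mul_cancel₀ (by positivity)]

lemma sq_psiWeight_half (γ : ℝ) (x : ℝ^[N]) : psiWeight (γ / 2) x ^ 2 = psiWeight γ x := by
  rw [psiWeight, psiWeight, ← Real.rpow_mul_natCast (by positivity)]
  congr 1
  push_cast
  ring

lemma psiWeight_le_of_le {γ c : ℝ} (hγ : 0 ≤ γ) (hc : 0 < c) {x y : ℝ^[N]}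
    (h : 1 + ‖y‖ ^ 2 ≤ c * (1 + ‖x‖ ^ 2)) : psiWeight γ x ≤ c ^ (γ / 2) * psiWeight γ y := by
  have hpow : (c * (1 + ‖x‖ ^ 2)) ^ (-γ / 2) ≤ (1 + ‖y‖ ^ 2) ^ (-γ / 2) :=
    Real.rpow_le_rpow_of_nonpos (by positivity) h (by linarith)
  rw [Real.mul_rpow hc.le (by positivity), neg_div, Real.rpow_neg hc.le,
    inv_mul_le_iff₀ (by positivity)] at hpow
  rwa [psiWeight, psiWeight, neg_div]

lemma norm_add_sq_le_two_mul {E : Type*} [SeminormedAddGroup E] (x z : E) :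
    ‖x + z‖ ^ 2 ≤ 2 * (‖x‖ ^ 2 + ‖z‖ ^ 2) :=
  (pow_le_pow_left₀ (norm_nonneg _) (norm_add_le x z) 2).trans add_sq_le

lemma psiWeight_peetre {γ : ℝ} (hγ : 0 ≤ γ) (x z : ℝ^[N]) :
    psiWeight γ z ≤ (2 * (1 + ‖x‖ ^ 2)) ^ (γ / 2) * psiWeight γ (x + z) := by
  refine psiWeight_le_of_le hγ (by positivity) ?_
  nlinarith [norm_add_sq_le_two_mul x z, mul_nonneg (sq_nonneg ‖x‖) (sq_nonneg ‖z‖)]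

lemma psiWeight_mul_le {γ : ℝ} (hγ : 0 ≤ γ) (x z : ℝ^[N]) :
    psiWeight γ z * psiWeight γ (x + z) ≤
      4 ^ (γ / 2) * psiWeight γ x * (psiWeight γ (x + z) + psiWeight γ z) := by
  have hx : ‖x‖ ^ 2 ≤ 2 * (‖x + z‖ ^ 2 + ‖z‖ ^ 2) := by
    simpa using norm_add_sq_le_two_mul (x + z) (-z)
  have h₁ := psiWeight_pos γ (x + z)
  have h₂ := psiWeight_pos γ z
  have h₃ : 0 < (4 : ℝ) ^ (γ / 2) * psiWeight γ x := mul_pos (by positivity) (psiWeight_pos γ x)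
  rcases le_total ‖z‖ ‖x + z‖ with hle | hle
  · have hsq : ‖z‖ ^ 2 ≤ ‖x + z‖ ^ 2 := by gcongr
    have := psiWeight_le_of_le hγ (x := x + z) (y := x) (c := 4) (by norm_num) (by linarith)
    nlinarith
  · have hsq : ‖x + z‖ ^ 2 ≤ ‖z‖ ^ 2 := by gcongr
    have := psiWeight_le_of_le hγ (x := z) (y := x) (c := 4) (by norm_num) (by linarith)
    nlinarith

lemma exists_psiWeight_eq_mul_rpow_neg (γ : ℝ) (x : ℝ^[N]) {z : ℝ^[N]} (hz : ‖z‖ ≤ 1) :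
    ∃ t : ℝ, 1 / 4 ≤ t ∧ |t - 1| ≤ 3 * ‖z‖ ∧
      t - 1 = (2 * inner ℝ x z + ‖z‖ ^ 2) / (1 + ‖x‖ ^ 2) ∧
      psiWeight γ (x + z) = psiWeight γ x * t ^ (-(γ / 2)) := by
  have hq : 0 < 1 + ‖x‖ ^ 2 := by positivity
  have hz0 := norm_nonneg z
  have hexpand := norm_add_sq_real x z
  have ht : (1 + ‖x + z‖ ^ 2) / (1 + ‖x‖ ^ 2) - 1 =
      (2 * inner ℝ x z + ‖z‖ ^ 2) / (1 + ‖x‖ ^ 2) := by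
    rw [hexpand]
    field_simp
    ring
  refine ⟨(1 + ‖x + z‖ ^ 2) / (1 + ‖x‖ ^ 2), ?_, ?_, ht, ?_⟩
  · have hx : ‖x‖ ^ 2 ≤ 2 * (‖x + z‖ ^ 2 + ‖z‖ ^ 2) := by
      simpa using norm_add_sq_le_two_mul (x + z) (-z)
    rw [le_div_iff₀ hq]
    nlinarith [sq_nonneg ‖x + z‖]
  · rw [ht, abs_div, abs_of_pos hq, div_le_iff₀ hq]
    have hinner := abs_real_inner_le_norm x z
    have hamgm : 2 * ‖x‖ * ‖z‖ ≤ (1 + ‖x‖ ^ 2) * ‖z‖ := by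
      gcongr
      nlinarith [sq_nonneg (‖x‖ - 1)]
    calc |2 * inner ℝ x z + ‖z‖ ^ 2| ≤ 2 * (‖x‖ * ‖z‖) + ‖z‖ ^ 2 :=
          (abs_add_le _ _).trans (by rw [abs_mul, abs_two, abs_sq]; gcongr)
      _ ≤ _ := by nlinarith [mul_nonneg hz0 (sq_nonneg ‖x‖), mul_nonneg hz0 (sub_nonneg.2 hz)]
  · rw [psiWeight, psiWeight, neg_div, Real.div_rpow (by positivity) hq.le]
    field_simp

/- The linear term is the differential of the weight; it is odd in `z` and so disappears from
symmetric second differences. -/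
lemma exists_psiWeight_expansion {γ : ℝ} (hγ : 0 ≤ γ) :
    ∃ M, 0 ≤ M ∧ ∀ x z : ℝ^[N], ‖z‖ ≤ 1 →
      |psiWeight γ (x + z) - psiWeight γ x +
        γ * (inner ℝ x z / (1 + ‖x‖ ^ 2)) * psiWeight γ x| ≤ M * psiWeight γ x * ‖z‖ ^ 2 := by
  set a := γ / 2 with ha
  set C := a * ((a + 1) * 4 ^ (a + 2))
  refine ⟨9 * C + a, by positivity, fun x z hz => ?_⟩
  obtain ⟨t, ht, ht₃, hteq, hψ⟩ := exists_psiWeight_eq_mul_rpow_neg γ x hz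
  have hψx := psiWeight_pos γ x
  have hrem : |t ^ (-a) - 1 + a * (t - 1)| ≤ 9 * C * ‖z‖ ^ 2 :=
    (abs_rpow_neg_sub_one_add_le (by positivity) ht).trans <| by
      have : (t - 1) ^ 2 ≤ (3 * ‖z‖) ^ 2 := sq_le_sq.2 (ht₃.trans (le_abs_self _))
      nlinarith [show 0 ≤ C by positivity]
  have hsq : |a * (‖z‖ ^ 2 / (1 + ‖x‖ ^ 2))| ≤ a * ‖z‖ ^ 2 := by
    rw [abs_of_nonneg (by positivity)]
    gcongr
    exact div_le_self (by positivity) (by nlinarith [sq_nonneg ‖x‖])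
  have hsplit : psiWeight γ (x + z) - psiWeight γ x +
      γ * (inner ℝ x z / (1 + ‖x‖ ^ 2)) * psiWeight γ x =
      psiWeight γ x * (t ^ (-a) - 1 + a * (t - 1) - a * (‖z‖ ^ 2 / (1 + ‖x‖ ^ 2))) := by
    rw [hψ, hteq, ha]
    ring
  rw [hsplit, abs_mul, abs_of_pos hψx]
  calc psiWeight γ x * |t ^ (-a) - 1 + a * (t - 1) - a * (‖z‖ ^ 2 / (1 + ‖x‖ ^ 2))|
      ≤ psiWeight γ x * (9 * C * ‖z‖ ^ 2 + a * ‖z‖ ^ 2) := by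
        gcongr
        exact (abs_sub _ _).trans (add_le_add hrem hsq)
    _ = _ := by ring

lemma exists_psiWeight_difference_bounds {γ : ℝ} (hγ : 0 ≤ γ) :
    ∃ M, 0 ≤ M ∧ ∀ x z : ℝ^[N], ‖z‖ ≤ 1 →
      |psiWeight γ (x + z) - psiWeight γ x| ≤ M * psiWeight γ x * ‖z‖ ∧
      psiWeight γ (x + z) + psiWeight γ (x - z) - 2 * psiWeight γ x ≤
        M * psiWeight γ x * ‖z‖ ^ 2 := by
  obtain ⟨M, hM, h⟩ := exists_psiWeight_expansion (N := N) hγ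
  refine ⟨2 * M + γ, by positivity, fun x z hz => ?_⟩
  have hψ := psiWeight_pos γ x
  have hz0 := norm_nonneg z
  have h₁ := h x z hz
  constructor
  · have hlin : |γ * (inner ℝ x z / (1 + ‖x‖ ^ 2)) * psiWeight γ x| ≤ γ * psiWeight γ x * ‖z‖ := by
      have hinner : |inner ℝ x z| ≤ ‖z‖ * (1 + ‖x‖ ^ 2) :=
        (abs_real_inner_le_norm x z).trans (by nlinarith [sq_nonneg (‖x‖ - 1)])
      rw [abs_mul, abs_mul, abs_of_nonneg hγ, abs_of_pos hψ, abs_div,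
        abs_of_pos (by positivity : 0 < 1 + ‖x‖ ^ 2), mul_right_comm]
      gcongr
      exact (div_le_iff₀ (by positivity)).2 hinner
    have hquad : M * psiWeight γ x * ‖z‖ ^ 2 ≤ 2 * M * psiWeight γ x * ‖z‖ := by
      nlinarith [mul_nonneg (mul_nonneg hM hψ.le) hz0, sq_nonneg ‖z‖]
    rw [abs_le] at h₁ hlin ⊢
    constructor <;> linarith
  · have h₂ := h x (-z) (by rwa [norm_neg])
    rw [inner_neg_right, norm_neg, ← sub_eq_add_neg, neg_div] at h₂
    have := mul_nonneg (mul_nonneg hγ hψ.le) (sq_nonneg ‖z‖)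
    linarith [(abs_le.1 h₁).2, (abs_le.1 h₂).2]

end Weight

section WeightedMeasure

/-- The measure `ψ_γ dx`, which for `γ = N + 2s` has the same integrable functions as the
weight `1 / (1 + |x|^{N+2s})` defining `𝓛^s`. -/
def psiMeasure (N : ℕ) (γ : ℝ) : Measure ℝ^[N] :=
  volume.withDensity fun x => ENNReal.ofReal (psiWeight γ x)

lemma integrable_psiMeasure_iff {γ : ℝ} {f : ℝ^[N] → ℝ} :
    Integrable f (psiMeasure N γ) ↔ Integrable fun x => psiWeight γ x * f x := by
  refine (integrable_withDensity_iff_integrable_smul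
    (continuous_psiWeight γ).measurable.real_toNNReal).trans (integrable_congr (ae_of_all _ ?_))
  intro x
  simp [NNReal.smul_def, (psiWeight_pos γ x).le]

lemma integral_psiMeasure (γ : ℝ) (f : ℝ^[N] → ℝ) :
    ∫ x, f x ∂psiMeasure N γ = ∫ x, psiWeight γ x * f x := by
  refine (integral_withDensity_eq_integral_smul
    (continuous_psiWeight γ).measurable.real_toNNReal f).trans (integral_congr_ae (ae_of_all _ ?_))
  intro x
  simp [NNReal.smul_def, (psiWeight_pos γ x).le]

lemma isFiniteMeasure_psiMeasure {γ : ℝ} (hγ : N < γ) : IsFiniteMeasure (psiMeasure N γ) :=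
  isFiniteMeasure_withDensity_ofReal (integrable_psiWeight hγ).2

lemma volume_absolutelyContinuous_psiMeasure (N : ℕ) (γ : ℝ) :
    (volume : Measure ℝ^[N]) ≪ psiMeasure N γ :=
  withDensity_absolutelyContinuous' (continuous_psiWeight γ).measurable.ennreal_ofReal.aemeasurable
    (ae_of_all _ fun x => by simpa using psiWeight_pos γ x)

instance (γ : ℝ) : (psiMeasure N γ).IsOpenPosMeasure :=
  (volume_absolutelyContinuous_psiMeasure N γ).isOpenPosMeasure

lemma map_add_left_psiMeasure_le {γ : ℝ} (hγ : 0 ≤ γ) (x : ℝ^[N]) :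
    (psiMeasure N γ).map (x + ·) ≤
      ((2 * (1 + ‖x‖ ^ 2)) ^ (γ / 2)).toNNReal • psiMeasure N γ := by
  set C := (2 * (1 + ‖x‖ ^ 2)) ^ (γ / 2)
  have hmeas : Measurable fun z : ℝ^[N] => ENNReal.ofReal (psiWeight γ z) :=
    (continuous_psiWeight γ).measurable.ennreal_ofReal
  refine Measure.le_iff.2 fun s hs => ?_
  have hshift : MeasurableSet ((x + ·) ⁻¹' s) := measurable_const_add x hs
  rw [Measure.map_apply (measurable_const_add x) hs, psiMeasure, withDensity_apply _ hshift,
    Measure.smul_apply, withDensity_apply _ hs,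
    ← (measurePreserving_add_left volume x).setLIntegral_comp_preimage hs hmeas,
    ENNReal.smul_def, smul_eq_mul, ← lintegral_const_mul' _ _ ENNReal.coe_ne_top]
  refine lintegral_mono fun z => ?_
  rw [← ENNReal.ofReal, ← ENNReal.ofReal_mul (by positivity)]
  exact ENNReal.ofReal_le_ofReal (psiWeight_peetre hγ x z)

lemma integrable_comp_add_left_psiMeasure {γ : ℝ} (hγ : 0 ≤ γ) {f : ℝ^[N] → ℝ}
    (hf : Integrable f (psiMeasure N γ)) (x : ℝ^[N]) :
    Integrable (fun z => f (x + z)) (psiMeasure N γ) :=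
  (hf.smul_measure_nnreal.mono_measure (map_add_left_psiMeasure_le hγ x)).comp_measurable
    (measurable_const_add x)

lemma integral_abs_comp_add_left_psiMeasure_le {γ : ℝ} (hγ : 0 ≤ γ) {f : ℝ^[N] → ℝ}
    (hf : Integrable f (psiMeasure N γ)) (x : ℝ^[N]) :
    ∫ z, |f (x + z)| ∂psiMeasure N γ ≤
      (2 * (1 + ‖x‖ ^ 2)) ^ (γ / 2) * ∫ z, |f z| ∂psiMeasure N γ := by
  have hle := map_add_left_psiMeasure_le hγ x
  have hint := hf.abs.smul_measure_nnreal (c := ((2 * (1 + ‖x‖ ^ 2)) ^ (γ / 2)).toNNReal)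
  rw [← integral_map (f := fun z => |f z|) (measurable_const_add x).aemeasurable
    (hint.mono_measure hle).1]
  refine (integral_mono_measure hle (ae_of_all _ fun z => abs_nonneg _) hint).trans_eq ?_
  rw [integral_smul_nnreal_measure, NNReal.smul_def, smul_eq_mul,
    Real.coe_toNNReal _ (by positivity)]

lemma exists_integral_psiWeight_comp_add_left_le {γ : ℝ} (hγ : N < γ) :
    ∃ C, 0 ≤ C ∧ ∀ x : ℝ^[N], ∫ z, psiWeight γ (x + z) ∂psiMeasure N γ ≤ C * psiWeight γ x := by
  have hγ0 : 0 ≤ γ := N.cast_nonneg.trans hγ.le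
  have hint := integrable_psiWeight hγ
  have hnonneg : 0 ≤ ∫ z : ℝ^[N], psiWeight γ z := integral_nonneg fun z => (psiWeight_pos γ z).le
  refine ⟨4 ^ (γ / 2) * (2 * ∫ z : ℝ^[N], psiWeight γ z), by positivity, fun x => ?_⟩
  rw [integral_psiMeasure]
  calc ∫ z, psiWeight γ z * psiWeight γ (x + z)
      ≤ ∫ z, 4 ^ (γ / 2) * psiWeight γ x * (psiWeight γ (x + z) + psiWeight γ z) :=
        integral_mono_of_nonneg
          (ae_of_all _ fun z => mul_nonneg (psiWeight_pos γ z).le (psiWeight_pos γ _).le)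
          (((hint.comp_add_left x).add hint).const_mul _)
          (ae_of_all _ fun z => psiWeight_mul_le hγ0 x z)
    _ = _ := by
        rw [integral_const_mul, integral_add (hint.comp_add_left x) hint,
          integral_add_left_eq_self (fun z : ℝ^[N] => psiWeight γ z)]
        ring

lemma psiWeight_mul_one_add_norm_rpow_le {γ : ℝ} (hγ : 0 ≤ γ) (x : ℝ^[N]) :
    psiWeight γ x * (1 + ‖x‖ ^ γ) ≤ 2 := by
  have hpow : ‖x‖ ^ γ ≤ (1 + ‖x‖ ^ 2) ^ (γ / 2) := by
    calc ‖x‖ ^ γ = (‖x‖ ^ 2) ^ (γ / 2) := by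
          rw [← Real.rpow_natCast_mul (norm_nonneg _)]
          congr 1
          push_cast
          ring
      _ ≤ _ := by gcongr; linarith
  calc psiWeight γ x * (1 + ‖x‖ ^ γ)
      ≤ psiWeight γ x * (1 + (1 + ‖x‖ ^ 2) ^ (γ / 2)) := by
        gcongr
        exact (psiWeight_pos γ x).le
    _ = psiWeight γ x + 1 := by rw [mul_add, psiWeight_mul_rpow, mul_one]
    _ ≤ 2 := by linarith [psiWeight_le_one hγ x]

lemma MemLs.integrable_psiMeasure {s : ℝ} (hs : 0 ≤ s) {f : ℝ^[N] → ℝ} (hf : MemLs s f) :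
    Integrable f (psiMeasure N (N + 2 * s)) := by
  set γ : ℝ := N + 2 * s
  have hγ : 0 ≤ γ := by positivity
  have hratio : Continuous fun x : ℝ^[N] => psiWeight γ x * (1 + ‖x‖ ^ γ) :=
    (continuous_psiWeight γ).mul
      (continuous_const.add (continuous_norm.rpow_const fun _ => Or.inr hγ))
  refine integrable_psiMeasure_iff.2
    ((Integrable.mul_bdd (c := 2) hf hratio.aestronglyMeasurable (ae_of_all _ fun x => ?_)).congr
      (ae_of_all _ fun x => ?_))
  · have := psiWeight_pos γ x
    rw [Real.norm_of_nonneg (by positivity)]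
    exact psiWeight_mul_one_add_norm_rpow_le hγ x
  · have : 0 < 1 + ‖x‖ ^ γ := by positivity
    change f x / (1 + ‖x‖ ^ γ) * (psiWeight γ x * (1 + ‖x‖ ^ γ)) = psiWeight γ x * f x
    field_simp

end WeightedMeasure

section Cutoff

/-- The compactly supported test functions `(ψ^{1/2} - δ)₊²`, which increase to the weight
`ψ = ψ_γ` as `δ → 0⁺`; here `ψ_γ^{1/2} = ψ_{γ/2}`. -/
def psiCutoff (γ δ : ℝ) (x : ℝ^[N]) : ℝ :=
  (max (psiWeight (γ / 2) x - δ) 0) ^ 2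

lemma psiCutoff_nonneg (γ δ : ℝ) (x : ℝ^[N]) : 0 ≤ psiCutoff γ δ x :=
  sq_nonneg _

lemma psiCutoff_le (γ : ℝ) {δ : ℝ} (hδ : 0 ≤ δ) (x : ℝ^[N]) : psiCutoff γ δ x ≤ psiWeight γ x := by
  have := psiWeight_pos (γ / 2) x
  rw [← sq_psiWeight_half, psiCutoff]
  gcongr
  exact max_le (by linarith) this.le

lemma continuous_psiCutoff (γ δ : ℝ) : Continuous (psiCutoff γ δ : ℝ^[N] → ℝ) :=
  (((continuous_psiWeight _).sub continuous_const).max continuous_const).pow 2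

lemma tendsto_psiCutoff (γ : ℝ) (x : ℝ^[N]) :
    Tendsto (fun δ => psiCutoff γ δ x) (𝓝[>] 0) (𝓝 (psiWeight γ x)) := by
  have hcont : Continuous fun δ : ℝ => psiCutoff γ δ x := by unfold psiCutoff; fun_prop
  have h := (hcont.tendsto 0).mono_left (nhdsWithin_le_nhds (s := Set.Ioi 0))
  simpa [psiCutoff, (psiWeight_pos (γ / 2) x).le, sq_psiWeight_half] using h

lemma tendsto_psiWeight_cocompact {γ : ℝ} (hγ : 0 < γ) :
    Tendsto (psiWeight γ : ℝ^[N] → ℝ) (cocompact _) (𝓝 0) := by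
  have hsq : Tendsto (fun x : ℝ^[N] => 1 + ‖x‖ ^ 2) (cocompact _) atTop :=
    tendsto_atTop_add_const_left _ _
      ((tendsto_pow_atTop two_ne_zero).comp (tendsto_norm_cocompact_atTop))
  refine ((tendsto_rpow_neg_atTop (half_pos hγ)).comp hsq).congr fun x => ?_
  simp [psiWeight, neg_div]

lemma hasCompactSupport_psiCutoff {γ δ : ℝ} (hγ : 0 < γ) (hδ : 0 < δ) :
    HasCompactSupport (psiCutoff γ δ : ℝ^[N] → ℝ) := by
  obtain ⟨t, ht, hsmall⟩ := mem_cocompact.1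
    ((tendsto_psiWeight_cocompact (N := N) (half_pos hγ)).eventually (gt_mem_nhds hδ))
  refine HasCompactSupport.intro ht fun x hx => ?_
  have hlt : psiWeight (γ / 2) x < δ := hsmall hx
  rw [psiCutoff, max_eq_right (by linarith), zero_pow two_ne_zero]

lemma exists_psiCutoff_second_difference_le {γ : ℝ} (hγ : 0 ≤ γ) :
    ∃ M, 0 ≤ M ∧ ∀ δ, 0 ≤ δ → ∀ x z : ℝ^[N], ‖z‖ ≤ 1 →
      psiCutoff γ δ (x + z) + psiCutoff γ δ (x - z) - 2 * psiCutoff γ δ x ≤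
        M * psiWeight γ x * ‖z‖ ^ 2 := by
  obtain ⟨M, hM, h⟩ := exists_psiWeight_difference_bounds (N := N) (div_nonneg hγ zero_le_two)
  refine ⟨2 * M + 2 * M ^ 2, by positivity, fun δ hδ x z hz => ?_⟩
  set G := psiWeight (γ / 2) x with hG
  set m := max (G - δ) 0
  have hG0 : 0 < G := psiWeight_pos (γ / 2) x
  have hmG : m ≤ G := max_le (by linarith) hG0.le
  have hstep (w : ℝ^[N]) (hw : ‖w‖ = ‖z‖) : psiCutoff γ δ (x + w) ≤
      m ^ 2 + 2 * m * (psiWeight (γ / 2) (x + w) - G) + (M * G * ‖z‖) ^ 2 := by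
    have hsq : (psiWeight (γ / 2) (x + w) - G) ^ 2 ≤ (M * G * ‖z‖) ^ 2 := by
      rw [← sq_abs, ← hw]
      gcongr
      exact (h x w (hw.trans_le hz)).1
    have := sq_max_zero_le (G - δ) (psiWeight (γ / 2) (x + w) - δ)
    rw [sub_sub_sub_cancel_right] at this
    exact this.trans (by gcongr)
  have h₁ := hstep z rfl
  have h₂ := hstep (-z) (norm_neg z)
  rw [← sub_eq_add_neg] at h₂
  have hsecond : m * (psiWeight (γ / 2) (x + z) + psiWeight (γ / 2) (x - z) - 2 * G) ≤
      G * (M * G * ‖z‖ ^ 2) :=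
    (mul_le_mul_of_nonneg_left (h x z hz).2 (le_max_right _ _)).trans (by gcongr)
  rw [← sq_psiWeight_half, ← hG]
  change _ - 2 * m ^ 2 ≤ _
  linarith

end Cutoff

section JumpOperator

variable {G : Type*} [MeasurableSpace G]

/-- The jump operator `f ↦ ∫ (f(x+z) - f(x)) dμ(z)`. -/
def jumpOp [Add G] (μ : Measure G) (f : G → ℝ) (x : G) : ℝ :=
  ∫ z, (f (x + z) - f x) ∂μ

lemma jumpOp_add_measure [Add G] {μ ν : Measure G} [IsFiniteMeasure μ] [IsFiniteMeasure ν]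
    {f : G → ℝ} {x : G} (hμ : Integrable (fun z => f (x + z)) μ)
    (hν : Integrable (fun z => f (x + z)) ν) :
    jumpOp (μ + ν) f x = jumpOp μ f x + jumpOp ν f x :=
  integral_add_measure (hμ.sub (integrable_const _)) (hν.sub (integrable_const _))

lemma mul_jumpOp_le_of_subgradient [Add G] {μ : Measure G} [IsFiniteMeasure μ] {Φ : ℝ → ℝ}
    {u : G → ℝ} {x : G} {m : ℝ} (hu : Integrable (fun z => u (x + z)) μ)
    (hΦu : Integrable (fun z => Φ (u (x + z))) μ)
    (hm : ∀ b, m * (b - u x) ≤ Φ b - Φ (u x)) :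
    m * jumpOp μ u x ≤ jumpOp μ (fun y => Φ (u y)) x := by
  rw [jumpOp, ← integral_const_mul]
  exact integral_mono ((hu.sub (integrable_const _)).const_mul m) (hΦu.sub (integrable_const _))
    fun z => hm (u (x + z))

lemma stronglyMeasurable_jumpOp [Add G] [MeasurableAdd₂ G] {μ : Measure G} [SFinite μ]
    {f : G → ℝ} (hf : Measurable f) : StronglyMeasurable (jumpOp μ f) :=
  StronglyMeasurable.integral_prod_right' (f := fun q : G × G => f (q.1 + q.2) - f q.1)
    (by fun_prop : Measurable fun q : G × G => f (q.1 + q.2) - f q.1).stronglyMeasurable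

lemma integrable_mul_jumpOp [Add G] {μ ν : Measure G} [IsFiniteMeasure μ] [SFinite ν] {v w : G → ℝ}
    (hvw : Integrable (fun q : G × G => v q.2 * w (q.2 + q.1)) (μ.prod ν))
    (hvw₀ : Integrable (fun x => v x * w x) ν) :
    Integrable (fun x => v x * jumpOp μ w x) ν := by
  simpa only [jumpOp, Pi.sub_apply, ← mul_sub, integral_const_mul] using
    (hvw.sub (hvw₀.comp_snd μ)).integral_prod_right

lemma integral_mul_jumpOp [Add G] {μ ν : Measure G} [IsFiniteMeasure μ] [SFinite ν] {v w : G → ℝ}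
    (hvw : Integrable (fun q : G × G => v q.2 * w (q.2 + q.1)) (μ.prod ν))
    (hvw₀ : Integrable (fun x => v x * w x) ν) :
    ∫ x, v x * jumpOp μ w x ∂ν =
      ∫ q, v q.2 * w (q.2 + q.1) ∂μ.prod ν - ∫ q, v q.2 * w q.2 ∂μ.prod ν := by
  have hsnd := hvw₀.comp_snd μ
  rw [← integral_sub' hvw hsnd, integral_prod_symm _ (hvw.sub hsnd)]
  simp only [jumpOp, Pi.sub_apply, ← mul_sub, integral_const_mul]

section Symmetry

variable [AddGroup G] [MeasurableAdd₂ G] [MeasurableNeg G] {μ ν : Measure G}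

lemma measurePreserving_neg_prod_add (μ ν : Measure G) [SFinite μ] [SFinite ν] [μ.IsNegInvariant]
    [ν.IsAddRightInvariant] :
    MeasurePreserving (fun q : G × G => (-q.1, q.2 + q.1)) (μ.prod ν) (μ.prod ν) :=
  (Measure.measurePreserving_neg μ).skew_product (by fun_prop)
    (ae_of_all _ fun z => (measurePreserving_add_right ν z).map_eq)

variable [IsFiniteMeasure μ] [SFinite ν] [μ.IsNegInvariant] [ν.IsAddRightInvariant] {v w : G → ℝ}

lemma integrable_mul_comp_add_swap
    (hvw : Integrable (fun q : G × G => v q.2 * w (q.2 + q.1)) (μ.prod ν)) :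
    Integrable (fun q : G × G => w q.2 * v (q.2 + q.1)) (μ.prod ν) := by
  have := (measurePreserving_neg_prod_add μ ν).integrable_comp_of_integrable hvw
  simpa [Function.comp_def, mul_comm] using this

lemma integral_mul_jumpOp_comm
    (hvw : Integrable (fun q : G × G => v q.2 * w (q.2 + q.1)) (μ.prod ν))
    (hvw₀ : Integrable (fun x => v x * w x) ν) :
    ∫ x, v x * jumpOp μ w x ∂ν = ∫ x, w x * jumpOp μ v x ∂ν := by
  have hT := measurePreserving_neg_prod_add μ ν
  have hswap : ∫ q, w q.2 * v (q.2 + q.1) ∂μ.prod ν = ∫ q, v q.2 * w (q.2 + q.1) ∂μ.prod ν := by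
    have := integral_map (f := fun q : G × G => v q.2 * w (q.2 + q.1)) hT.aemeasurable
      (hT.map_eq.symm ▸ hvw.1)
    rw [hT.map_eq] at this
    simpa [mul_comm] using this.symm
  rw [integral_mul_jumpOp hvw hvw₀, integral_mul_jumpOp (integrable_mul_comp_add_swap hvw)
    (by simpa only [mul_comm] using hvw₀), hswap]
  simp only [mul_comm]

end Symmetry

end JumpOperator

section JumpMeasure

lemma integrableOn_unitBall_of_continuous {μ : Measure ℝ^[N]} [IsFiniteMeasure μ] {f : ℝ^[N] → ℝ}
    (hf : Continuous f) : IntegrableOn f (Metric.ball 0 1) μ :=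
  (hf.continuousOn.integrableOn_compact (isCompact_closedBall 0 1)).mono_set
    Metric.ball_subset_closedBall

/-- Finite symmetric jump measures with second moment at most `A` in the unit ball and tail at
most `B ψ_γ dz`. The bounds on the jump operators of this class depend on `μ` only through
`A` and `B`, so that they survive a limit of jump measures of unbounded total mass. -/
structure IsJumpMeasure (γ A : ℝ) (B : NNReal) (μ : Measure ℝ^[N]) : Prop
    extends IsFiniteMeasure μ, μ.IsNegInvariant where
  small : ∫ z in Metric.ball 0 1, ‖z‖ ^ 2 ∂μ ≤ A
  tail : μ.restrict (Metric.ball 0 1)ᶜ ≤ B • psiMeasure N γ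

namespace IsJumpMeasure

variable {γ A A' : ℝ} {B B' : NNReal} {μ ν : Measure ℝ^[N]} {f : ℝ^[N] → ℝ}

lemma add (hμ : IsJumpMeasure γ A B μ) (hν : IsJumpMeasure γ A' B' ν) :
    IsJumpMeasure γ (A + A') (B + B') (μ + ν) := by
  have := hμ.toIsFiniteMeasure
  have := hν.toIsFiniteMeasure
  have := hμ.toIsNegInvariant
  have := hν.toIsNegInvariant
  have hsq : Continuous fun z : ℝ^[N] => ‖z‖ ^ 2 := by fun_prop
  refine { neg_eq_self := ?_, small := ?_, tail := ?_ }
  · rw [Measure.neg, Measure.map_add _ _ measurable_neg]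
    exact congrArg₂ _ hμ.neg_eq_self hν.neg_eq_self
  · rw [Measure.restrict_add, integral_add_measure (integrableOn_unitBall_of_continuous hsq)
      (integrableOn_unitBall_of_continuous hsq)]
    exact add_le_add hμ.small hν.small
  · rw [Measure.restrict_add, add_smul]
    exact add_le_add hμ.tail hν.tail

lemma smul (hμ : IsJumpMeasure γ A B μ) (c : NNReal) :
    IsJumpMeasure γ (c * A) (c * B) (c • μ) := by
  have := hμ.toIsFiniteMeasure
  refine { neg_eq_self := ?_, small := ?_, tail := ?_ }
  · rw [Measure.neg, Measure.map_smul]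
    exact congrArg (c • ·) hμ.neg_eq_self
  · rw [Measure.restrict_smul, integral_smul_nnreal_measure, NNReal.smul_def, smul_eq_mul]
    exact mul_le_mul_of_nonneg_left hμ.small c.2
  · rw [Measure.restrict_smul, mul_smul]
    gcongr
    exact hμ.tail

lemma zero (γ : ℝ) : IsJumpMeasure γ 0 0 (0 : Measure ℝ^[N]) where
  measure_univ_lt_top := by simp
  neg_eq_self := by simp [Measure.neg]
  small := by simp
  tail := by simp

lemma sum {ι : Type*} {A : ι → ℝ} {B : ι → NNReal} {μ : ι → Measure ℝ^[N]} {t : Finset ι}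
    (hμ : ∀ i ∈ t, IsJumpMeasure γ (A i) (B i) (μ i)) :
    IsJumpMeasure γ (∑ i ∈ t, A i) (∑ i ∈ t, B i) (∑ i ∈ t, μ i) := by
  induction t using Finset.cons_induction with
  | empty => exact zero γ
  | cons i t hi ih =>
    simp only [Finset.sum_cons]
    exact (hμ i (Finset.mem_cons_self i t)).add
      (ih fun j hj => hμ j (Finset.mem_cons_of_mem hj))

lemma dirac_add_dirac_neg (γ : ℝ) {a : ℝ^[N]} (ha : ‖a‖ < 1) :
    IsJumpMeasure γ (2 * ‖a‖ ^ 2) 0 (Measure.dirac a + Measure.dirac (-a)) where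
  measure_univ_lt_top := measure_lt_top _ _
  neg_eq_self := by
    rw [Measure.neg, Measure.map_add _ _ measurable_neg, Measure.map_dirac' measurable_neg,
      Measure.map_dirac' measurable_neg, neg_neg, add_comm]
  small := by
    have hint (b : ℝ^[N]) : Integrable (fun z => ‖z‖ ^ 2) (Measure.dirac b) :=
      integrable_dirac enorm_lt_top
    refine (setIntegral_le_integral ((hint _).add_measure (hint _))
      (ae_of_all _ fun z => sq_nonneg ‖z‖)).trans_eq ?_
    rw [integral_add_measure (hint _) (hint _), integral_dirac, integral_dirac, norm_neg, two_mul]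
  tail := by
    have hball : MeasurableSet (Metric.ball (0 : ℝ^[N]) 1)ᶜ :=
      Metric.isOpen_ball.measurableSet.compl
    classical
    rw [Measure.restrict_add, restrict_dirac' hball, restrict_dirac' hball,
      if_neg (by simpa using ha), if_neg (by simpa using ha), add_zero, zero_smul]

lemma integrable (hμ : IsJumpMeasure γ A B μ) (hf : Continuous f)
    (hfψ : Integrable f (psiMeasure N γ)) : Integrable f μ := by
  have := hμ.toIsFiniteMeasure
  have htail : IntegrableOn f (Metric.ball 0 1)ᶜ μ :=
    hfψ.smul_measure_nnreal.mono_measure hμ.tail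
  rw [← integrableOn_univ, ← Set.union_compl_self (Metric.ball 0 1)]
  exact (integrableOn_unitBall_of_continuous hf).union htail

lemma integral_compl_ball_le (hμ : IsJumpMeasure γ A B μ) (hfψ : Integrable f (psiMeasure N γ)) :
    ∫ z in (Metric.ball 0 1)ᶜ, f z ∂μ ≤ B * ∫ z, |f z| ∂psiMeasure N γ := by
  have hint := hfψ.abs.smul_measure_nnreal (c := B)
  calc ∫ z in (Metric.ball 0 1)ᶜ, f z ∂μ ≤ ∫ z in (Metric.ball 0 1)ᶜ, |f z| ∂μ :=
        (le_abs_self _).trans abs_integral_le_integral_abs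
    _ ≤ ∫ z, |f z| ∂(B • psiMeasure N γ) :=
        integral_mono_measure hμ.tail (ae_of_all _ fun z => abs_nonneg _) hint
    _ = _ := by rw [integral_smul_nnreal_measure, NNReal.smul_def, smul_eq_mul]

lemma integral_ball_le (hμ : IsJumpMeasure γ A B μ) (hf : Continuous f) {M : ℝ} (hM : 0 ≤ M)
    (hfM : ∀ z, ‖z‖ ≤ 1 → f z + f (-z) ≤ M * ‖z‖ ^ 2) :
    ∫ z in Metric.ball 0 1, f z ∂μ ≤ M * A / 2 := by
  have := hμ.toIsFiniteMeasure
  have := hμ.toIsNegInvariant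
  have hint {g : ℝ^[N] → ℝ} (hg : Continuous g) : IntegrableOn g (Metric.ball 0 1) μ :=
    integrableOn_unitBall_of_continuous hg
  have hneg : ∫ z in Metric.ball 0 1, f (-z) ∂μ = ∫ z in Metric.ball 0 1, f z ∂μ := by
    simpa using (Measure.measurePreserving_neg μ).setIntegral_preimage_emb
      (MeasurableEquiv.neg ℝ^[N]).measurableEmbedding f (Metric.ball 0 1)
  have hsum : ∫ z in Metric.ball 0 1, (f z + f (-z)) ∂μ ≤ M * A :=
    calc ∫ z in Metric.ball 0 1, (f z + f (-z)) ∂μ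
        ≤ ∫ z in Metric.ball 0 1, M * ‖z‖ ^ 2 ∂μ :=
          setIntegral_mono_on (hint (by fun_prop)) (hint (by fun_prop))
            Metric.isOpen_ball.measurableSet fun z hz => hfM z (mem_ball_zero_iff.1 hz).le
      _ ≤ M * A := by
          rw [integral_const_mul]
          gcongr
          exact hμ.small
  rw [integral_add (hint hf) (hint (by fun_prop)), hneg] at hsum
  linarith

lemma jumpOp_le (hμ : IsJumpMeasure γ A B μ) (hγ : N < γ) (hf : Continuous f)
    (hfψ : Integrable f (psiMeasure N γ)) {x : ℝ^[N]} {M : ℝ} (hM : 0 ≤ M)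
    (hfM : ∀ z, ‖z‖ ≤ 1 → f (x + z) + f (x - z) - 2 * f x ≤ M * ‖z‖ ^ 2) :
    jumpOp μ f x ≤ M * A / 2 + B * ∫ z, |f (x + z) - f x| ∂psiMeasure N γ := by
  have := isFiniteMeasure_psiMeasure hγ
  have hint : Integrable (fun z => f (x + z) - f x) (psiMeasure N γ) :=
    (integrable_comp_add_left_psiMeasure (N.cast_nonneg.trans hγ.le) hfψ x).sub (integrable_const _)
  have hcont : Continuous fun z => f (x + z) - f x := by fun_prop
  rw [jumpOp, ← integral_add_compl Metric.isOpen_ball.measurableSet (hμ.integrable hcont hint)]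
  refine add_le_add (hμ.integral_ball_le hcont hM fun z hz => ?_) (hμ.integral_compl_ball_le hint)
  linarith [hfM z hz, congrArg f (sub_eq_add_neg x z)]

lemma abs_jumpOp_le (hμ : IsJumpMeasure γ A B μ) (hγ : N < γ) (hf : Continuous f)
    (hfψ : Integrable f (psiMeasure N γ)) {x : ℝ^[N]} {M : ℝ} (hM : 0 ≤ M)
    (hfM : ∀ z, ‖z‖ ≤ 1 → |f (x + z) + f (x - z) - 2 * f x| ≤ M * ‖z‖ ^ 2) :
    |jumpOp μ f x| ≤ M * A / 2 + B * ∫ z, |f (x + z) - f x| ∂psiMeasure N γ := by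
  have hneg : jumpOp μ (fun y => -f y) x = -jumpOp μ f x := by
    rw [jumpOp, jumpOp, ← integral_neg]
    congr 1 with z
    ring
  refine abs_le'.2 ⟨hμ.jumpOp_le hγ hf hfψ hM fun z hz => (abs_le.1 (hfM z hz)).2, ?_⟩
  have := hμ.jumpOp_le (f := fun y => -f y) (x := x) hγ hf.neg hfψ.neg hM fun z hz => by
    linarith [(abs_le.1 (hfM z hz)).1]
  simpa only [hneg, neg_sub_neg, abs_sub_comm] using this

end IsJumpMeasure

variable {γ : ℝ}

lemma integrable_psiWeight_psiMeasure (hγ : N < γ) :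
    Integrable (psiWeight γ) (psiMeasure N γ) := by
  have := isFiniteMeasure_psiMeasure hγ
  refine Integrable.of_bound (continuous_psiWeight γ).aestronglyMeasurable 1
    (ae_of_all _ fun x => ?_)
  rw [Real.norm_of_nonneg (psiWeight_pos γ x).le]
  exact psiWeight_le_one (N.cast_nonneg.trans hγ.le) x

lemma integrable_psiCutoff_psiMeasure (hγ : N < γ) {δ : ℝ} (hδ : 0 ≤ δ) :
    Integrable (psiCutoff γ δ) (psiMeasure N γ) :=
  (integrable_psiWeight_psiMeasure hγ).mono' (continuous_psiCutoff γ δ).aestronglyMeasurable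
    (ae_of_all _ fun x => by
      rw [Real.norm_of_nonneg (psiCutoff_nonneg γ δ x)]
      exact psiCutoff_le γ hδ x)

lemma exists_jumpOp_psiCutoff_le (hγ : N < γ) (A : ℝ) (B : NNReal) :
    ∃ K, ∀ μ : Measure ℝ^[N], IsJumpMeasure γ A B μ → ∀ δ, 0 ≤ δ → ∀ x,
      jumpOp μ (psiCutoff γ δ) x ≤ K * psiWeight γ x := by
  have hγ0 : 0 ≤ γ := N.cast_nonneg.trans hγ.le
  have := isFiniteMeasure_psiMeasure hγ
  obtain ⟨M, hM, hsecond⟩ := exists_psiCutoff_second_difference_le (N := N) hγ0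
  obtain ⟨C, -, hC⟩ := exists_integral_psiWeight_comp_add_left_le hγ
  refine ⟨M * A / 2 + B * (C + (psiMeasure N γ).real Set.univ), fun μ hμ δ hδ x => ?_⟩
  have hψ := psiWeight_pos γ x
  have hshift := integrable_comp_add_left_psiMeasure hγ0 (integrable_psiWeight_psiMeasure hγ) x
  have htail : ∫ z, |psiCutoff γ δ (x + z) - psiCutoff γ δ x| ∂psiMeasure N γ ≤
      (C + (psiMeasure N γ).real Set.univ) * psiWeight γ x := by
    calc ∫ z, |psiCutoff γ δ (x + z) - psiCutoff γ δ x| ∂psiMeasure N γ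
        ≤ ∫ z, (psiWeight γ (x + z) + psiWeight γ x) ∂psiMeasure N γ := by
          refine integral_mono_of_nonneg (ae_of_all _ fun z => abs_nonneg _)
            (hshift.add (integrable_const _)) (ae_of_all _ fun z => (abs_sub _ _).trans ?_)
          rw [abs_of_nonneg (psiCutoff_nonneg _ _ _), abs_of_nonneg (psiCutoff_nonneg _ _ _)]
          exact add_le_add (psiCutoff_le γ hδ _) (psiCutoff_le γ hδ x)
      _ ≤ _ := by
          rw [integral_add hshift (integrable_const _), integral_const, smul_eq_mul, add_mul]
          gcongr
          exact hC x
  calc jumpOp μ (psiCutoff γ δ) x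
      ≤ M * psiWeight γ x * A / 2 +
          B * ∫ z, |psiCutoff γ δ (x + z) - psiCutoff γ δ x| ∂psiMeasure N γ :=
        hμ.jumpOp_le hγ (continuous_psiCutoff γ δ) (integrable_psiCutoff_psiMeasure hγ hδ)
          (by positivity) (hsecond δ hδ x)
    _ ≤ M * psiWeight γ x * A / 2 +
          B * ((C + (psiMeasure N γ).real Set.univ) * psiWeight γ x) := by gcongr
    _ = _ := by ring

lemma exists_abs_jumpOp_le (hγ : N < γ) (A : ℝ) (B : NNReal) {u : ℝ^[N] → ℝ} (hu : ContDiff ℝ 2 u)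
    (huψ : Integrable u (psiMeasure N γ)) (R : ℝ) :
    ∃ C, ∀ μ, IsJumpMeasure γ A B μ → ∀ x, ‖x‖ ≤ R → |jumpOp μ u x| ≤ C := by
  have hγ0 : 0 ≤ γ := N.cast_nonneg.trans hγ.le
  have := isFiniteMeasure_psiMeasure hγ
  obtain ⟨M, hM, hsecond⟩ := exists_abs_second_difference_le hu R
  obtain ⟨U, hU⟩ := (isCompact_closedBall (0 : ℝ^[N]) R).exists_bound_of_continuousOn
    hu.continuous.continuousOn
  set T := (2 * (1 + R ^ 2)) ^ (γ / 2) * (∫ z, |u z| ∂psiMeasure N γ) +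
    (psiMeasure N γ).real Set.univ * U
  refine ⟨M * A / 2 + B * T, fun μ hμ x hx => ?_⟩
  have hshift := integrable_comp_add_left_psiMeasure hγ0 huψ x
  have htail : ∫ z, |u (x + z) - u x| ∂psiMeasure N γ ≤ T := by
    calc ∫ z, |u (x + z) - u x| ∂psiMeasure N γ
        ≤ ∫ z, (|u (x + z)| + |u x|) ∂psiMeasure N γ :=
          integral_mono (hshift.sub (integrable_const _)).abs
            (hshift.abs.add (integrable_const _)) fun z => abs_sub _ _
      _ = (∫ z, |u (x + z)| ∂psiMeasure N γ) + (psiMeasure N γ).real Set.univ * |u x| := by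
          rw [integral_add hshift.abs (integrable_const _), integral_const, smul_eq_mul]
      _ ≤ T := by
          refine add_le_add
            ((integral_abs_comp_add_left_psiMeasure_le hγ0 huψ x).trans ?_) ?_
          · have : 0 ≤ ∫ z, |u z| ∂psiMeasure N γ := integral_nonneg fun z => abs_nonneg _
            gcongr
          · gcongr
            exact hU x (by simpa using hx)
  exact (hμ.abs_jumpOp_le hγ hu.continuous huψ hM fun z hz => hsecond x z hx hz).trans (by gcongr)

end JumpMeasure

section PowerSubgradient

/-- The derivative `p |a|^(p-2) a` of `|·|^p`, with the value `0` at `a = 0`, where it is a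
subgradient for every `p ≥ 1`. -/
def absRpowSubgradient (p a : ℝ) : ℝ :=
  p * |a| ^ (p - 2) * a

lemma measurable_absRpowSubgradient (p : ℝ) : Measurable (absRpowSubgradient p) := by
  unfold absRpowSubgradient
  fun_prop

lemma abs_absRpowSubgradient {p a : ℝ} (hp : 0 ≤ p) (ha : a ≠ 0) :
    |absRpowSubgradient p a| = p * |a| ^ (p - 1) := by
  rw [absRpowSubgradient, abs_mul, abs_of_nonneg (by positivity), mul_assoc,
    ← Real.rpow_add_one (abs_ne_zero.2 ha)]
  ring_nf

lemma absRpowSubgradient_mul_self {p : ℝ} (hp : p ≠ 0) (a : ℝ) :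
    absRpowSubgradient p a * a = p * |a| ^ p := by
  rcases eq_or_ne a 0 with rfl | ha
  · simp [hp]
  · rw [absRpowSubgradient, mul_assoc, ← sq, ← sq_abs, mul_assoc, ← Real.rpow_add_natCast
      (abs_ne_zero.2 ha)]
    norm_num

lemma absRpowSubgradient_mul_sub_le {p : ℝ} (hp : 1 ≤ p) (a b : ℝ) :
    absRpowSubgradient p a * (b - a) ≤ |b| ^ p - |a| ^ p := by
  have hp0 : p ≠ 0 := by linarith
  rw [mul_sub, absRpowSubgradient_mul_self hp0]
  rcases eq_or_ne a 0 with rfl | ha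
  · simpa [absRpowSubgradient, hp0] using Real.rpow_nonneg (abs_nonneg b) p
  have ha0 : 0 < |a| := abs_pos.2 ha
  have hb : absRpowSubgradient p a * b ≤ p * |a| ^ (p - 1) * |b| := by
    rw [← abs_absRpowSubgradient (by linarith) ha, ← abs_mul]
    exact le_abs_self _
  have hbernoulli := one_add_mul_self_le_rpow_one_add (s := |b| / |a| - 1)
    (by linarith [div_nonneg (abs_nonneg b) ha0.le]) hp
  rw [add_sub_cancel, Real.div_rpow (abs_nonneg _) ha0.le, le_div_iff₀ (by positivity)]
    at hbernoulli
  have hscale : (1 + p * (|b| / |a| - 1)) * |a| ^ p =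
      |a| ^ p + p * |a| ^ (p - 1) * |b| - p * |a| ^ p := by
    rw [Real.rpow_sub_one ha0.ne']
    field_simp
    ring
  linarith

lemma abs_absRpowSubgradient_le {p : ℝ} (hp : 1 ≤ p) (a : ℝ) :
    |absRpowSubgradient p a| ≤ p * (1 + |a| ^ p) := by
  rcases eq_or_ne a 0 with rfl | ha
  · simp only [absRpowSubgradient, mul_zero, abs_zero]
    positivity
  rw [abs_absRpowSubgradient (by linarith) ha]
  gcongr
  rcases le_total |a| 1 with hle | hle
  · linarith [Real.rpow_le_one (abs_nonneg a) hle (sub_nonneg.2 hp),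
      Real.rpow_nonneg (abs_nonneg a) p]
  · linarith [Real.rpow_le_rpow_of_exponent_le hle (sub_le_self p zero_le_one)]

lemma mul_abs_rpow_le_absRpowSubgradient_mul {p q a b : ℝ} (hp : 0 < p) (h : q * a ^ 2 ≤ b * a) :
    p * q * |a| ^ p ≤ absRpowSubgradient p a * b := by
  calc p * q * |a| ^ p = p * |a| ^ (p - 2) * (q * a ^ 2) := by
        rw [mul_right_comm, ← absRpowSubgradient_mul_self hp.ne', absRpowSubgradient]
        ring
    _ ≤ p * |a| ^ (p - 2) * (b * a) := by gcongr
    _ = _ := by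
        rw [absRpowSubgradient]
        ring

end PowerSubgradient

section EnergyInequality

variable {γ A K δ p : ℝ} {B : NNReal} {μ : Measure ℝ^[N]} {u w : ℝ^[N] → ℝ}

lemma IsJumpMeasure.integrable_mul_psiCutoff_comp_add (hμ : IsJumpMeasure γ A B μ) (hγ : N < γ)
    (hδ : 0 ≤ δ) (hK : ∀ x, jumpOp μ (psiCutoff γ δ) x ≤ K * psiWeight γ x) (hw : Continuous w)
    (hwψ : Integrable w (psiMeasure N γ)) :
    Integrable (fun q : ℝ^[N] × ℝ^[N] => w q.2 * psiCutoff γ δ (q.2 + q.1)) (μ.prod volume) := by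
  have := hμ.toIsFiniteMeasure
  have hφ := continuous_psiCutoff (N := N) γ δ
  have hmeas : AEStronglyMeasurable
      (fun q : ℝ^[N] × ℝ^[N] => w q.2 * psiCutoff γ δ (q.2 + q.1)) (μ.prod volume) :=
    (by fun_prop : Continuous _).aestronglyMeasurable
  have hshift (y : ℝ^[N]) : Integrable (fun z => psiCutoff γ δ (y + z)) μ :=
    hμ.integrable (by fun_prop) (integrable_comp_add_left_psiMeasure (N.cast_nonneg.trans hγ.le)
      (integrable_psiCutoff_psiMeasure hγ hδ) y)
  have hfiber (y : ℝ^[N]) :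
      ∫ z, psiCutoff γ δ (y + z) ∂μ ≤ (K + μ.real Set.univ) * psiWeight γ y := by
    have hjump : jumpOp μ (psiCutoff γ δ) y =
        ∫ z, psiCutoff γ δ (y + z) ∂μ - μ.real Set.univ * psiCutoff γ δ y := by
      rw [jumpOp, integral_sub (hshift y) (integrable_const _), integral_const, smul_eq_mul]
    have hφψ : μ.real Set.univ * psiCutoff γ δ y ≤ μ.real Set.univ * psiWeight γ y := by
      gcongr
      exact psiCutoff_le γ hδ y
    linarith [hK y]
  refine (integrable_prod_iff' hmeas).2 ⟨ae_of_all _ fun y => (hshift y).const_mul (w y), ?_⟩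
  refine ((integrable_psiMeasure_iff.1 hwψ.abs).const_mul (K + μ.real Set.univ)).mono'
    hmeas.norm.prod_swap.integral_prod_right' (ae_of_all _ fun y => ?_)
  have hnorm : ∫ z, ‖w y * psiCutoff γ δ (y + z)‖ ∂μ = |w y| * ∫ z, psiCutoff γ δ (y + z) ∂μ := by
    rw [← integral_const_mul]
    simp only [norm_mul, Real.norm_eq_abs, abs_of_nonneg (psiCutoff_nonneg γ δ _)]
  rw [Real.norm_of_nonneg (integral_nonneg fun z => norm_nonneg _)]
  change ∫ z, ‖w y * psiCutoff γ δ (y + z)‖ ∂μ ≤ _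
  rw [hnorm]
  exact (mul_le_mul_of_nonneg_left (hfiber y) (abs_nonneg _)).trans_eq (by ring)

lemma exists_integrable_bound_psiCutoff_mul_jumpOp (hγ : N < γ) (A : ℝ) (B : NNReal) (hδ : 0 < δ)
    (hp : 1 ≤ p) (hu : ContDiff ℝ 2 u) (huψ : Integrable u (psiMeasure N γ)) :
    ∃ F : ℝ^[N] → ℝ, Integrable F ∧ ∀ μ, IsJumpMeasure γ A B μ → ∀ x,
      |psiCutoff γ δ x * (absRpowSubgradient p (u x) * jumpOp μ u x)| ≤ F x := by
  have hsupp := hasCompactSupport_psiCutoff (N := N) ((Nat.cast_nonneg N).trans_lt hγ) hδ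
  obtain ⟨R, hR⟩ := hsupp.isCompact.isBounded.subset_closedBall 0
  obtain ⟨C, hC⟩ := exists_abs_jumpOp_le hγ A B hu huψ R
  have hcont : Continuous fun x => p * (1 + |u x| ^ p) * C :=
    ((continuous_const.add (hu.continuous.abs.rpow_const fun x => Or.inr (by linarith))).const_smul
      p).mul continuous_const
  refine ⟨fun x => psiCutoff γ δ x * (p * (1 + |u x| ^ p) * C),
    ((continuous_psiCutoff γ δ).mul hcont).integrable_of_hasCompactSupport hsupp.mul_right,
    fun μ hμ x => ?_⟩
  rw [abs_mul, abs_of_nonneg (psiCutoff_nonneg γ δ x), abs_mul]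
  rcases eq_or_ne (psiCutoff γ δ x) 0 with h0 | h0
  · simp [h0]
  have hx : ‖x‖ ≤ R := by simpa using hR (subset_tsupport _ h0)
  exact mul_le_mul_of_nonneg_left
    (mul_le_mul (abs_absRpowSubgradient_le hp (u x)) (hC μ hμ x hx) (abs_nonneg _) (by positivity))
    (psiCutoff_nonneg γ δ x)

lemma IsJumpMeasure.aestronglyMeasurable_psiCutoff_mul_jumpOp (hμ : IsJumpMeasure γ A B μ)
    (hu : Continuous u) : AEStronglyMeasurable
      fun x => psiCutoff γ δ x * (absRpowSubgradient p (u x) * jumpOp μ u x) := by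
  have := hμ.toIsFiniteMeasure
  exact (continuous_psiCutoff γ δ).aestronglyMeasurable.mul
    (((measurable_absRpowSubgradient p).comp hu.measurable).aestronglyMeasurable.mul
      (stronglyMeasurable_jumpOp hu.measurable).aestronglyMeasurable)

lemma IsJumpMeasure.integral_psiCutoff_mul_jumpOp_le (hμ : IsJumpMeasure γ A B μ) (hγ : N < γ)
    (hδ : 0 < δ) (hK : ∀ x, jumpOp μ (psiCutoff γ δ) x ≤ K * psiWeight γ x) (hp : 1 ≤ p)
    (hu : ContDiff ℝ 2 u) (huψ : Integrable u (psiMeasure N γ))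
    (hupψ : Integrable (fun x => |u x| ^ p) (psiMeasure N γ)) :
    ∫ x, psiCutoff γ δ x * (absRpowSubgradient p (u x) * jumpOp μ u x) ≤
      K * ∫ x, |u x| ^ p ∂psiMeasure N γ := by
  have := hμ.toIsFiniteMeasure
  have := hμ.toIsNegInvariant
  have hγ0 : 0 ≤ γ := N.cast_nonneg.trans hγ.le
  have hup : Continuous fun x => |u x| ^ p :=
    hu.continuous.abs.rpow_const fun x => Or.inr (by linarith)
  have hprod := hμ.integrable_mul_psiCutoff_comp_add hγ hδ.le hK hup hupψ
  have hprod' := integrable_mul_comp_add_swap (v := fun x => |u x| ^ p) hprod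
  have hup_φ : Integrable fun x => |u x| ^ p * psiCutoff γ δ x :=
    (hup.mul (continuous_psiCutoff γ δ)).integrable_of_hasCompactSupport
      (hasCompactSupport_psiCutoff ((Nat.cast_nonneg N).trans_lt hγ) hδ).mul_left
  obtain ⟨F, hF, hFbound⟩ := exists_integrable_bound_psiCutoff_mul_jumpOp hγ A B hδ hp hu huψ
  have hshift {f : ℝ^[N] → ℝ} (hf : Continuous f) (hfψ : Integrable f (psiMeasure N γ))
      (x : ℝ^[N]) : Integrable (fun z => f (x + z)) μ :=
    hμ.integrable (by fun_prop) (integrable_comp_add_left_psiMeasure hγ0 hfψ x)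
  calc ∫ x, psiCutoff γ δ x * (absRpowSubgradient p (u x) * jumpOp μ u x)
      ≤ ∫ x, psiCutoff γ δ x * jumpOp μ (fun y => |u y| ^ p) x := by
        refine integral_mono
          (hF.mono' (hμ.aestronglyMeasurable_psiCutoff_mul_jumpOp hu.continuous)
            (ae_of_all _ (hFbound μ hμ)))
          (integrable_mul_jumpOp hprod' (by simpa only [mul_comm] using hup_φ)) fun x => ?_
        exact mul_le_mul_of_nonneg_left
          (mul_jumpOp_le_of_subgradient (Φ := fun a => |a| ^ p) (hshift hu.continuous huψ x)
            (hshift hup hupψ x) fun b => absRpowSubgradient_mul_sub_le hp (u x) b)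
          (psiCutoff_nonneg γ δ x)
    _ = ∫ x, |u x| ^ p * jumpOp μ (psiCutoff γ δ) x :=
        (integral_mul_jumpOp_comm hprod hup_φ).symm
    _ ≤ ∫ x, K * (psiWeight γ x * |u x| ^ p) := by
        refine integral_mono (integrable_mul_jumpOp hprod hup_φ)
          ((integrable_psiMeasure_iff.1 hupψ).const_mul K) fun x => ?_
        exact (mul_le_mul_of_nonneg_left (hK x) (by positivity)).trans_eq (by ring)
    _ = K * ∫ x, |u x| ^ p ∂psiMeasure N γ := by
        rw [integral_const_mul, integral_psiMeasure]

end EnergyInequality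

section JumpLimit

variable {γ A K p q : ℝ} {B : NNReal} {μ : ℕ → Measure ℝ^[N]} {u L : ℝ^[N] → ℝ}

lemma mul_integral_psiCutoff_mul_le_of_tendsto_jumpOp (hγ : N < γ)
    (hμ : ∀ n, IsJumpMeasure γ A B (μ n)) {δ : ℝ} (hδ : 0 < δ)
    (hK : ∀ n x, jumpOp (μ n) (psiCutoff γ δ) x ≤ K * psiWeight γ x)
    (hp : 1 ≤ p) (hu : ContDiff ℝ 2 u) (huψ : Integrable u (psiMeasure N γ))
    (hupψ : Integrable (fun x => |u x| ^ p) (psiMeasure N γ))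
    (hL : ∀ x, Tendsto (fun n => jumpOp (μ n) u x) atTop (𝓝 (L x)))
    (hq : ∀ x, q * u x ^ 2 ≤ L x * u x) :
    p * q * ∫ x, psiCutoff γ δ x * |u x| ^ p ≤ K * ∫ x, |u x| ^ p ∂psiMeasure N γ := by
  have hup : Continuous fun x => |u x| ^ p :=
    hu.continuous.abs.rpow_const fun x => Or.inr (by linarith)
  obtain ⟨F, hF, hFbound⟩ := exists_integrable_bound_psiCutoff_mul_jumpOp hγ A B hδ hp hu huψ
  set g : ℕ → ℝ^[N] → ℝ := fun n x =>
    psiCutoff γ δ x * (absRpowSubgradient p (u x) * jumpOp (μ n) u x)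
  set gL : ℝ^[N] → ℝ := fun x => psiCutoff γ δ x * (absRpowSubgradient p (u x) * L x)
  have hlim (x : ℝ^[N]) : Tendsto (fun n => g n x) atTop (𝓝 (gL x)) :=
    ((hL x).const_mul _).const_mul _
  have hmeas (n : ℕ) : AEStronglyMeasurable (g n) :=
    (hμ n).aestronglyMeasurable_psiCutoff_mul_jumpOp hu.continuous
  have hbound (n : ℕ) (x : ℝ^[N]) : ‖g n x‖ ≤ F x := hFbound _ (hμ n) x
  have hgL : Integrable gL :=
    hF.mono' (aestronglyMeasurable_of_tendsto_ae atTop hmeas (ae_of_all _ hlim))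
      (ae_of_all _ fun x => le_of_tendsto' (hlim x).norm fun n => hbound n x)
  calc p * q * ∫ x, psiCutoff γ δ x * |u x| ^ p
      = ∫ x, psiCutoff γ δ x * (p * q * |u x| ^ p) := by
        rw [← integral_const_mul]
        congr 1 with x
        ring
    _ ≤ ∫ x, gL x := by
        refine integral_mono ?_ hgL fun x => mul_le_mul_of_nonneg_left
          (mul_abs_rpow_le_absRpowSubgradient_mul (by linarith) (hq x)) (psiCutoff_nonneg γ δ x)
        exact ((continuous_psiCutoff γ δ).mul
          (continuous_const.mul hup)).integrable_of_hasCompactSupport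
          (hasCompactSupport_psiCutoff ((Nat.cast_nonneg N).trans_lt hγ) hδ).mul_right
    _ ≤ K * ∫ x, |u x| ^ p ∂psiMeasure N γ :=
        le_of_tendsto' (tendsto_integral_of_dominated_convergence F hmeas hF
          (fun n => ae_of_all _ (hbound n)) (ae_of_all _ hlim))
          fun n => (hμ n).integral_psiCutoff_mul_jumpOp_le hγ hδ (hK n) hp hu huψ hupψ

lemma tendsto_integral_psiCutoff_mul {f : ℝ^[N] → ℝ} (hf : Integrable f (psiMeasure N γ)) :
    Tendsto (fun δ => ∫ x, psiCutoff γ δ x * f x) (𝓝[>] 0) (𝓝 (∫ x, f x ∂psiMeasure N γ)) := by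
  have hψf := integrable_psiMeasure_iff.1 hf
  rw [integral_psiMeasure]
  refine tendsto_integral_filter_of_dominated_convergence (fun x => ‖psiWeight γ x * f x‖)
    (Eventually.of_forall fun δ => (continuous_psiCutoff γ δ).aestronglyMeasurable.mul
      (hf.1.mono_ac (volume_absolutelyContinuous_psiMeasure N γ))) ?_ hψf.norm
    (ae_of_all _ fun x => (tendsto_psiCutoff γ x).mul_const _)
  filter_upwards [self_mem_nhdsWithin] with δ hδ
  refine ae_of_all _ fun x => ?_
  rw [norm_mul, norm_mul, Real.norm_of_nonneg (psiCutoff_nonneg γ δ x),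
    Real.norm_of_nonneg (psiWeight_pos γ x).le]
  gcongr
  exact psiCutoff_le γ (le_of_lt hδ) x

theorem eq_zero_of_tendsto_jumpOp (hγ : N < γ)
    (hμ : ∀ n, IsJumpMeasure γ A B (μ n))
    (hK : ∀ δ, 0 ≤ δ → ∀ n x, jumpOp (μ n) (psiCutoff γ δ) x ≤ K * psiWeight γ x)
    (hp : 1 ≤ p) (hKpq : K < p * q) (hu : ContDiff ℝ 2 u) (huψ : Integrable u (psiMeasure N γ))
    (hupψ : Integrable (fun x => |u x| ^ p) (psiMeasure N γ))
    (hL : ∀ x, Tendsto (fun n => jumpOp (μ n) u x) atTop (𝓝 (L x)))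
    (hq : ∀ x, q * u x ^ 2 ≤ L x * u x) : u = 0 := by
  have hp0 : p ≠ 0 := by linarith
  have hup : Continuous fun x => |u x| ^ p :=
    hu.continuous.abs.rpow_const fun x => Or.inr (by linarith)
  have henergy : p * q * ∫ x, |u x| ^ p ∂psiMeasure N γ ≤ K * ∫ x, |u x| ^ p ∂psiMeasure N γ :=
    le_of_tendsto ((tendsto_integral_psiCutoff_mul hupψ).const_mul (p * q)) <| by
      filter_upwards [self_mem_nhdsWithin] with δ hδ
      exact mul_integral_psiCutoff_mul_le_of_tendsto_jumpOp hγ hμ hδ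
        (hK δ (le_of_lt hδ)) hp hu huψ hupψ hL hq
  have hnonneg : 0 ≤ fun x => |u x| ^ p := fun x => by positivity
  have hzero : ∫ x, |u x| ^ p ∂psiMeasure N γ = 0 :=
    le_antisymm (by nlinarith) (integral_nonneg hnonneg)
  have hup0 := (hup.ae_eq_iff_eq (psiMeasure N γ) continuous_zero).1
    ((integral_eq_zero_iff_of_nonneg hnonneg hupψ).1 hzero)
  funext x
  simpa [Real.rpow_eq_zero (abs_nonneg (u x)) hp0] using congrFun hup0 x

end JumpLimit

section LevyMeasure

/-- The measure `|z|^{-γ} dz`, which for `γ = N + 2s` is, up to the factor `C_{N,s}`, the Lévy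
measure of `-(-Δ)^s`. -/
def radialPowerMeasure (N : ℕ) (γ : ℝ) : Measure ℝ^[N] :=
  volume.withDensity fun z => ENNReal.ofReal (‖z‖ ^ (-γ))

variable {γ : ℝ}

instance (γ : ℝ) : (radialPowerMeasure N γ).IsNegInvariant where
  neg_eq_self := by
    ext S hS
    have hmeas : Measurable fun z : ℝ^[N] => ENNReal.ofReal (‖z‖ ^ (-γ)) := by fun_prop
    rw [Measure.neg, Measure.map_apply measurable_neg hS, radialPowerMeasure,
      withDensity_apply _ (measurable_neg hS), withDensity_apply _ hS,
      ← (Measure.measurePreserving_neg volume).setLIntegral_comp_preimage hS hmeas]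
    simp only [norm_neg]

lemma isNegInvariant_restrict_ball_compl {G : Type*} [SeminormedAddCommGroup G]
    [MeasurableSpace G] [BorelSpace G] (μ : Measure G) [μ.IsNegInvariant] (r : ℝ) :
    (μ.restrict (Metric.ball 0 r)ᶜ).IsNegInvariant where
  neg_eq_self := by
    have := (Measure.measurePreserving_neg μ).restrict_preimage
      (s := (Metric.ball (0 : G) r)ᶜ) Metric.isOpen_ball.measurableSet.compl
    simpa [Measure.neg] using this.map_eq

lemma norm_rpow_neg_le_psiWeight (hγ : 0 ≤ γ) {r : ℝ} (hr : 0 < r) {z : ℝ^[N]} (hz : r ≤ ‖z‖) :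
    ‖z‖ ^ (-γ) ≤ (1 + (r ^ 2)⁻¹) ^ (γ / 2) * psiWeight γ z := by
  have hz₀ : 0 < ‖z‖ := hr.trans_le hz
  have hsq : 1 + ‖z‖ ^ 2 ≤ (1 + (r ^ 2)⁻¹) * ‖z‖ ^ 2 := by
    have : 1 ≤ (r ^ 2)⁻¹ * ‖z‖ ^ 2 := by
      rw [inv_mul_eq_div, one_le_div₀ (by positivity)]
      gcongr
    linarith
  have hpow := Real.rpow_le_rpow_of_nonpos (by positivity) hsq (by linarith : -(γ / 2) ≤ 0)
  rw [Real.mul_rpow (by positivity) (by positivity), Real.rpow_neg (by positivity),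
    inv_mul_le_iff₀ (by positivity), ← Real.rpow_natCast_mul hz₀.le,
    Nat.cast_two, mul_neg, mul_div_cancel₀ _ two_ne_zero] at hpow
  rwa [psiWeight, neg_div]

lemma restrict_radialPowerMeasure_le (hγ : 0 ≤ γ) {r : ℝ} (hr : 0 < r) :
    (radialPowerMeasure N γ).restrict (Metric.ball 0 r)ᶜ ≤
      ((1 + (r ^ 2)⁻¹) ^ (γ / 2)).toNNReal • psiMeasure N γ := by
  have hball : MeasurableSet (Metric.ball (0 : ℝ^[N]) r)ᶜ := Metric.isOpen_ball.measurableSet.compl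
  have hψ : Measurable fun z : ℝ^[N] => ENNReal.ofReal (psiWeight γ z) :=
    (continuous_psiWeight γ).measurable.ennreal_ofReal
  calc (radialPowerMeasure N γ).restrict (Metric.ball 0 r)ᶜ
      = (volume.restrict (Metric.ball 0 r)ᶜ).withDensity
          fun z => ENNReal.ofReal (‖z‖ ^ (-γ)) := restrict_withDensity hball _
    _ ≤ (volume.restrict (Metric.ball 0 r)ᶜ).withDensity
          (ENNReal.ofReal ((1 + (r ^ 2)⁻¹) ^ (γ / 2)) •
            fun z => ENNReal.ofReal (psiWeight γ z)) := by
        refine withDensity_mono ((ae_restrict_iff' hball).2 (ae_of_all _ fun z hz => ?_))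
        rw [Pi.smul_apply, smul_eq_mul, ← ENNReal.ofReal_mul (by positivity)]
        exact ENNReal.ofReal_le_ofReal (norm_rpow_neg_le_psiWeight hγ hr (by simpa using hz))
    _ = ((1 + (r ^ 2)⁻¹) ^ (γ / 2)).toNNReal • (psiMeasure N γ).restrict (Metric.ball 0 r)ᶜ := by
        rw [withDensity_smul _ hψ, ← restrict_withDensity hball]
        rfl
    _ ≤ _ := by
        gcongr
        exact Measure.restrict_le_self

lemma setIntegral_radialPowerMeasure {f : ℝ^[N] → ℝ} {t : Set ℝ^[N]} (ht : MeasurableSet t) :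
    ∫ z in t, f z ∂radialPowerMeasure N γ = ∫ z in t, ‖z‖ ^ (-γ) * f z := by
  have hmeas : Measurable fun z : ℝ^[N] => (‖z‖ ^ (-γ)).toNNReal := by fun_prop
  refine (setIntegral_withDensity_eq_setIntegral_smul hmeas f ht).trans
    (integral_congr_ae (ae_of_all _ fun z => ?_))
  simp [NNReal.smul_def, Real.rpow_nonneg]

lemma integrableOn_sq_norm_radialPowerMeasure (hN : 1 ≤ N) (hγ : γ < N + 2) :
    IntegrableOn (fun z : ℝ^[N] => ‖z‖ ^ 2) (Metric.ball 0 1) (radialPowerMeasure N γ) := by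
  have : Nonempty (Fin N) := ⟨⟨0, hN⟩⟩
  have hmeas : Measurable fun z : ℝ^[N] => (‖z‖ ^ (-γ)).toNNReal := by fun_prop
  have hradial : IntegrableOn (fun z : ℝ^[N] => ‖z‖ ^ (-γ) * ‖z‖ ^ 2) (Metric.ball 0 1) := by
    rw [integrableOn_fun_norm_addHaar volume (f := fun r => r ^ (-γ) * r ^ 2),
      finrank_euclideanSpace_fin]
    refine ((intervalIntegral.integrableOn_Ioo_rpow_iff one_pos).2
      (by linarith : -1 < N + 1 - γ)).congr_fun (fun r hr => ?_) measurableSet_Ioo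
    rw [smul_eq_mul, ← Real.rpow_natCast, ← Real.rpow_natCast, ← Real.rpow_add hr.1,
      ← Real.rpow_add hr.1]
    push_cast [hN]
    ring_nf
  rw [radialPowerMeasure, IntegrableOn, restrict_withDensity Metric.isOpen_ball.measurableSet]
  refine (integrable_withDensity_iff_integrable_smul hmeas).2
    (hradial.congr (ae_of_all _ fun z => ?_))
  simp [NNReal.smul_def, Real.rpow_nonneg]

lemma isJumpMeasure_restrict_radialPowerMeasure (hN : 1 ≤ N) (hNγ : N < γ) (hγ : γ < N + 2)
    {ε : ℝ} (hε : 0 < ε) :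
    IsJumpMeasure γ (∫ z in Metric.ball 0 1, ‖z‖ ^ 2 ∂radialPowerMeasure N γ)
      ((2 : ℝ) ^ (γ / 2)).toNNReal ((radialPowerMeasure N γ).restrict (Metric.ball 0 ε)ᶜ) := by
  have hγ₀ : 0 ≤ γ := N.cast_nonneg.trans hNγ.le
  have := isFiniteMeasure_psiMeasure hNγ
  refine { isFiniteMeasure_of_le _ (restrict_radialPowerMeasure_le hγ₀ hε),
    isNegInvariant_restrict_ball_compl (radialPowerMeasure N γ) ε with small := ?_, tail := ?_ }
  · exact integral_mono_measure (Measure.restrict_mono_measure Measure.restrict_le_self _)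
      (ae_of_all _ fun z => sq_nonneg ‖z‖) (integrableOn_sq_norm_radialPowerMeasure hN hγ)
  · have htail := restrict_radialPowerMeasure_le (N := N) hγ₀ one_pos
    norm_num at htail
    exact (Measure.restrict_mono_measure Measure.restrict_le_self _).trans htail

end LevyMeasure

section Approximation

/-- The truncated Lévy measure `C_{N,s} 1_{|z| ≥ ε} |z|^{-N-2s} dz`, whose jump operator
approximates `-(-Δ)^s`. -/
def fracJumpMeasure (N : ℕ) (s ε : ℝ) : Measure ℝ^[N] :=
  (fracLapConst N s).toNNReal • (radialPowerMeasure N (N + 2 * s)).restrict (Metric.ball 0 ε)ᶜ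

/-- The point masses `ε⁻²` at `±ε eᵢ`, whose jump operator is the second-difference
approximation of the Laplacian. -/
def laplaceJumpMeasure (N : ℕ) (ε : ℝ) : Measure ℝ^[N] :=
  (ε ^ 2)⁻¹.toNNReal • ∑ i, (Measure.dirac (ε • EuclideanSpace.basisFun (Fin N) ℝ i) +
    Measure.dirac (-(ε • EuclideanSpace.basisFun (Fin N) ℝ i)))

variable {s ε : ℝ} {u : ℝ^[N] → ℝ} {x : ℝ^[N]}

lemma fracLapConst_nonneg (hs0 : 0 < s) (hs1 : s < 1) : 0 ≤ fracLapConst N s := by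
  have hΓ : 0 < Real.Gamma (1 - s) := Real.Gamma_pos_of_pos (by linarith)
  have hΓ' : 0 < Real.Gamma ((N + 2 * s) / 2) := Real.Gamma_pos_of_pos (by positivity)
  exact div_nonneg (mul_nonneg (by positivity) hΓ'.le) (mul_nonneg (by positivity) hΓ.le)

lemma isJumpMeasure_laplaceJumpMeasure (γ : ℝ) (hε0 : 0 < ε) (hε1 : ε < 1) :
    IsJumpMeasure γ (2 * N) 0 (laplaceJumpMeasure N ε) := by
  have hnorm (i : Fin N) : ‖ε • EuclideanSpace.basisFun (Fin N) ℝ i‖ = ε := by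
    rw [norm_smul, (EuclideanSpace.basisFun (Fin N) ℝ).norm_eq_one, mul_one,
      Real.norm_of_nonneg hε0.le]
  have hsum := (IsJumpMeasure.sum (t := Finset.univ) fun i _ =>
    IsJumpMeasure.dirac_add_dirac_neg γ ((hnorm i).trans_lt hε1)).smul (ε ^ 2)⁻¹.toNNReal
  rw [laplaceJumpMeasure]
  convert hsum using 1
  · simp only [hnorm, Finset.sum_const, Finset.card_univ, Fintype.card_fin, nsmul_eq_mul]
    rw [Real.coe_toNNReal _ (by positivity)]
    field_simp
  · simp

lemma jumpOp_laplaceJumpMeasure (u : ℝ^[N] → ℝ) (x : ℝ^[N]) (ε : ℝ) :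
    jumpOp (laplaceJumpMeasure N ε) u x =
      ∑ i, (u (x + ε • EuclideanSpace.basisFun (Fin N) ℝ i) +
        u (x - ε • EuclideanSpace.basisFun (Fin N) ℝ i) - 2 * u x) / ε ^ 2 := by
  have hint (a : ℝ^[N]) : Integrable (fun z => u (x + z) - u x) (Measure.dirac a) :=
    integrable_dirac enorm_lt_top
  rw [jumpOp, laplaceJumpMeasure, integral_smul_nnreal_measure, NNReal.smul_def,
    integral_finsetSum_measure fun i _ => (hint _).add_measure (hint _), smul_eq_mul,
    Finset.mul_sum, Real.coe_toNNReal _ (by positivity)]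
  refine Finset.sum_congr rfl fun i _ => ?_
  rw [integral_add_measure (hint _) (hint _), integral_dirac, integral_dirac, ← sub_eq_add_neg]
  ring

lemma tendsto_jumpOp_laplaceJumpMeasure (hu : ContDiff ℝ 2 u) (x : ℝ^[N]) :
    Tendsto (fun ε => jumpOp (laplaceJumpMeasure N ε) u x) (𝓝[>] 0)
      (𝓝 (Laplacian.laplacian u x)) := by
  simp only [jumpOp_laplaceJumpMeasure, iteratedFDeriv_two_apply,
    InnerProductSpace.laplacian_eq_iteratedFDeriv_orthonormalBasis u
      (EuclideanSpace.basisFun (Fin N) ℝ)]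
  exact tendsto_finsetSum Finset.univ fun i _ =>
    tendsto_second_difference hu x (EuclideanSpace.basisFun (Fin N) ℝ i)

lemma isJumpMeasure_fracJumpMeasure (hN : 1 ≤ N) (hs0 : 0 < s) (hs1 : s < 1) (hε : 0 < ε) :
    IsJumpMeasure (N + 2 * s)
      ((fracLapConst N s).toNNReal *
        ∫ z in Metric.ball (0 : ℝ^[N]) 1, ‖z‖ ^ 2 ∂radialPowerMeasure N (N + 2 * s))
      ((fracLapConst N s).toNNReal * ((2 : ℝ) ^ (((N : ℝ) + 2 * s) / 2)).toNNReal)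
      (fracJumpMeasure N s ε) :=
  (isJumpMeasure_restrict_radialPowerMeasure hN (by linarith) (by linarith) hε).smul _

lemma jumpOp_fracJumpMeasure (hs0 : 0 < s) (hs1 : s < 1) (u : ℝ^[N] → ℝ) (x : ℝ^[N]) (ε : ℝ) :
    jumpOp (fracJumpMeasure N s ε) u x =
      -(fracLapConst N s *
        ∫ y in {y | ε ≤ ‖x - y‖}, (u x - u y) / ‖x - y‖ ^ ((N : ℝ) + 2 * s)) := by
  have hball : MeasurableSet (Metric.ball (0 : ℝ^[N]) ε)ᶜ := Metric.isOpen_ball.measurableSet.compl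
  have hshift := (measurePreserving_add_left volume x).setIntegral_preimage_emb
    (measurableEmbedding_addLeft x) (fun y => (u x - u y) / ‖x - y‖ ^ ((N : ℝ) + 2 * s))
    {y | ε ≤ ‖x - y‖}
  have hpre : (x + ·) ⁻¹' {y | ε ≤ ‖x - y‖} = (Metric.ball (0 : ℝ^[N]) ε)ᶜ := by
    ext z
    simp
  rw [jumpOp, fracJumpMeasure, integral_smul_nnreal_measure, NNReal.smul_def,
    Real.coe_toNNReal _ (fracLapConst_nonneg hs0 hs1), setIntegral_radialPowerMeasure hball,
    ← hshift, hpre, smul_eq_mul, ← mul_neg, ← integral_neg]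
  congr 2 with z
  rw [sub_add_cancel_left, norm_neg, Real.rpow_neg (norm_nonneg z)]
  ring

lemma tendsto_jumpOp_fracJumpMeasure (hs0 : 0 < s) (hs1 : s < 1) {v : ℝ}
    (hv : HasFracLaplacianAt s u x v) :
    Tendsto (fun ε => jumpOp (fracJumpMeasure N s ε) u x) (𝓝[>] 0) (𝓝 (-v)) := by
  simpa only [jumpOp_fracJumpMeasure hs0 hs1] using hv.neg

/-- Jump measures whose jump operators approximate `Δ - (-Δ)^s`. -/
def mixedJumpMeasure (N : ℕ) (s ε : ℝ) : Measure ℝ^[N] :=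
  fracJumpMeasure N s ε + laplaceJumpMeasure N ε

lemma exists_isJumpMeasure_mixedJumpMeasure (hN : 1 ≤ N) (hs0 : 0 < s) (hs1 : s < 1) :
    ∃ A B, ∀ ε ∈ Set.Ioo (0 : ℝ) 1, IsJumpMeasure (N + 2 * s) A B (mixedJumpMeasure N s ε) :=
  ⟨_, _, fun _ hε => (isJumpMeasure_fracJumpMeasure hN hs0 hs1 hε.1).add
    (isJumpMeasure_laplaceJumpMeasure _ hε.1 hε.2)⟩

lemma tendsto_jumpOp_mixedJumpMeasure (hN : 1 ≤ N) (hs0 : 0 < s) (hs1 : s < 1)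
    (hu : ContDiff ℝ 2 u) (huψ : Integrable u (psiMeasure N (N + 2 * s))) {v : ℝ}
    (hv : HasFracLaplacianAt s u x v) :
    Tendsto (fun ε => jumpOp (mixedJumpMeasure N s ε) u x) (𝓝[>] 0)
      (𝓝 (Laplacian.laplacian u x - v)) := by
  rw [sub_eq_neg_add]
  refine ((tendsto_jumpOp_fracJumpMeasure hs0 hs1 hv).add
    (tendsto_jumpOp_laplaceJumpMeasure hu x)).congr' ?_
  filter_upwards [Ioo_mem_nhdsGT one_pos] with ε hε
  have hfrac := isJumpMeasure_fracJumpMeasure hN hs0 hs1 hε.1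
  have hlap := isJumpMeasure_laplaceJumpMeasure (N := N) (N + 2 * s) hε.1 hε.2
  have := hfrac.toIsFiniteMeasure
  have := hlap.toIsFiniteMeasure
  have hcont : Continuous fun z => u (x + z) := hu.continuous.comp (continuous_const_add x)
  have hshift := integrable_comp_add_left_psiMeasure (by positivity) huψ x
  exact (jumpOp_add_measure (hfrac.integrable hcont hshift) (hlap.integrable hcont hshift)).symm

end Approximation

theorem corollary2p7_general (N : ℕ) (hN : 1 ≤ N) (s : ℝ) (hs0 : 0 < s) (hs1 : s < 1) :
    ∃ K : ℝ, ∀ (ρ c : ℝ^[N] → ℝ) (q p : ℝ), (∀ x, q ≤ ρ x * c x) → 1 ≤ p → K < p * q →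
      ∀ u, IsClassicalSolution s ρ c u → MemLs s (fun x => |u x| ^ p) → ∀ x, u x = 0 := by
  have hγ : (N : ℝ) < N + 2 * s := by linarith
  obtain ⟨A, B, hjump⟩ := exists_isJumpMeasure_mixedJumpMeasure hN hs0 hs1
  obtain ⟨K, hK⟩ := exists_jumpOp_psiCutoff_le hγ A B
  refine ⟨K, fun ρ c q p hq hp hKpq u hu hup x => ?_⟩
  obtain ⟨ε, hε, hε01⟩ := exists_seq_forall_of_frequently
    (eventually_mem_set.2 (Ioo_mem_nhdsGT (one_pos : (0 : ℝ) < 1))).frequently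
  have huψ := hu.memLs.integrable_psiMeasure hs0.le
  choose v hv heq using hu.equation
  refine congrFun (eq_zero_of_tendsto_jumpOp hγ (fun n => hjump _ (hε01 n))
    (fun δ hδ n => hK _ (hjump _ (hε01 n)) δ hδ) hp hKpq hu.contDiff huψ
    (hup.integrable_psiMeasure hs0.le)
    (fun x => (tendsto_jumpOp_mixedJumpMeasure hN hs0 hs1 hu.contDiff huψ (hv x)).comp hε)
    fun x => ?_) x
  rw [sub_eq_zero.1 (heq x), mul_assoc, ← sq]
  exact mul_le_mul_of_nonneg_right (hq x) (sq_nonneg (u x))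

end

theorem corollary2p7 (N : ℕ) (hN : 1 ≤ N) (s : ℝ) (hs0 : 0 < s) (hs1 : s < 1)
    (β : ℝ) (hβ0 : 0 < β) (hβ : β ≤ N + 2 * s) (C₀ : ℝ) (hC₀ : 0 < C₀) :
    ∃ K : ℝ, ∀ ρ c : EuclideanSpace ℝ (Fin N) → ℝ,
      DensityCondition 0 C₀ ρ → PotentialCondition c →
      ∀ c₀ : ℝ, 0 < c₀ → (∀ x, c₀ ≤ c x) →
      ∀ p : ℝ, 1 ≤ p → K < p * c₀ →
      ∀ u : EuclideanSpace ℝ (Fin N) → ℝ,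
        IsClassicalSolution s ρ c u →
        MemLs s (fun x => |u x| ^ p) →
        MemWeightedLp p (psiWeight β) u →
        ∀ x, u x = 0 := by
  obtain ⟨K, hK⟩ := corollary2p7_general N hN s hs0 hs1
  refine ⟨K / C₀, fun ρ c hρ _ c₀ hc₀ hc p hp hKp u hu hup _ => ?_⟩
  refine hK ρ c (C₀ * c₀) p (fun x => ?_) hp (by linarith [(div_lt_iff₀ hC₀).1 hKp]) u hu hup
  have hρx : C₀ ≤ ρ x := by simpa using hρ.lower_bound x
  exact mul_le_mul hρx (hc x) hc₀.le (hC₀.le.trans hρx)
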